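/- Let $\mathcal{O}$ be a complete discrete valuation ring of characteristic $0$ whose residue field $F$ is algebraically closed of characteristic $2$. For a finite group $H$ let $\mathbb{Z}\operatorname{Irr}(H)$ be the ring of generalized complex characters of $H$, and for a commutative ring $R$ put $R\operatorname{Irr}(H)=R\otimes_{\mathbb{Z}}\mathbb{Z}\operatorname{Irr}(H)$. Let $H_2$ be the set of elements of $H$ whose order is a power of $2$. If $\mathcal{O}\operatorname{Irr}(H)$ contains the characteristic function of $H_2$, let $e\in F\operatorname{Irr}(H)$ be the reduction of this function; it is an idempotent, and $B_2(H)=F\operatorname{Irr}(H)e$, a ring with identity element $e$, is called the principal block of $F\operatorname{Irr}(H)$. The Loewy length of $B_2(H)$ is the least $n$ such that $J(B_2(H))^n=0$, where $J$ denotes the Jacobson radical. For $s\in\{1,2\}$ let $G=G_s\cong C_8^2\rtimes C_3\rtimes C_4$ be the group $(A\rtimes\langle z\rangle)\rtimes\langle t\rangle$, where $A=\mathbb{Z}[\omega]/(8)\cong C_8^2$ with $\omega^2+\omega+1=0$, $z$ has order $3$ and acts on $A$ as multiplication by $\omega$, and $t$ has order $4$, inverts $z$ and acts on $A$ by $v\mapsto(s-\omega)\overline{v}$,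 where $\overline{\omega}=\omega^2$ (so that $t^2$ acts on $A$ as multiplication by $s^2+s+1$, i.e. by $3$ if $s=1$ and by $-1$ if $s=2$). Let $P$ be a Sylow $2$-subgroup of $G$. Then $G$ is solvable of order $768=2^8\cdot 3$; the characteristic functions of $G_2$ and of $\mathrm{N}_G(P)_2$ belong to $\mathcal{O}\operatorname{Irr}(G)$ and to $\mathcal{O}\operatorname{Irr}(\mathrm{N}_G(P))$, respectively (each being given by a unique element); the principal block $B_2(G)$ has Loewy length $5$, and the principal block $B_2(\mathrm{N}_G(P))$ has Loewy length $6$. In particular $B_2(G)$ and $B_2(\mathrm{N}_G(P))$ have different Loewy lengths. -/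

import Mathlib

open scoped TensorProduct

namespace CharacterRing

/-! ### The character ring and its principal block -/

section Ring

variable (G : Type) [Group G]

/-- The characters of the finite-dimensional complex representations of `G`. -/
def characters : Set (G → ℂ) :=
  {f | ∃ (V : Type) (_ : AddCommGroup V) (_ : Module ℂ V) (_ : FiniteDimensional ℂ V)
    (ρ : Representation ℂ G V), f = ρ.character}

theorem one_mem_characters : (1 : G → ℂ) ∈ characters G := by
  refine ⟨ℂ, inferInstance, inferInstance, inferInstance, Representation.trivial ℂ G ℂ, ?_⟩
  ext g
  simp [Representation.character]

theorem mul_mem_characters {f₁ f₂ : G → ℂ} (h₁ : f₁ ∈ characters G) (h₂ : f₂ ∈ characters G) :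
    f₁ * f₂ ∈ characters G := by
  obtain ⟨V, _, _, _, ρ, rfl⟩ := h₁
  obtain ⟨W, _, _, _, σ, rfl⟩ := h₂
  exact ⟨V ⊗[ℂ] W, inferInstance, inferInstance, inferInstance, ρ.tprod σ,
    (Representation.char_tensor ρ σ).symm⟩

/-- The character ring `ℤ Irr(G)`: the ring of complex functions on `G` whose additive group is
generated by the characters of `G`. -/
def ZIrr : Subring (G → ℂ) where
  __ := AddSubgroup.closure (characters G)
  one_mem' := AddSubgroup.subset_closure (one_mem_characters G)
  mul_mem' {a b} ha hb := by
    refine AddSubgroup.closure_induction₂ (p := fun x y _ _ =>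
      x * y ∈ AddSubgroup.closure (characters G)) ?_ ?_ ?_ ?_ ?_ ?_ ?_ ha hb
    · exact fun x y hx hy => AddSubgroup.subset_closure (mul_mem_characters G hx hy)
    · intro x _; simp
    · intro x _; simp
    · intro x y z _ _ _ h1 h2; rw [add_mul]; exact add_mem h1 h2
    · intro x y z _ _ _ h1 h2; rw [mul_add]; exact add_mem h1 h2
    · intro x y _ _ h; rw [neg_mul]; exact neg_mem h
    · intro x y _ _ h; rw [mul_neg]; exact neg_mem h

/-- The scalar extension `R Irr(G) = R ⊗_ℤ ℤ Irr(G)` of the character ring. -/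
def Irr (R : Type*) [CommRing R] : Type _ := R ⊗[ℤ] ZIrr G

noncomputable instance Irr.instCommRing (R : Type*) [CommRing R] : CommRing (Irr G R) :=
  inferInstanceAs (CommRing (R ⊗[ℤ] ZIrr G))

/-- The ring homomorphism `R Irr(G) → R' Irr(G)` given by a ring homomorphism `R → R'`. -/
noncomputable def Irr.map {R R' : Type*} [CommRing R] [CommRing R'] (f : R →+* R') :
    Irr G R →+* Irr G R' :=
  (Algebra.TensorProduct.map f.toIntAlgHom (AlgHom.id ℤ (ZIrr G))).toRingHom

variable {G}

/-- The value at `g` of a character with coefficients in `R`; it lies in `R ⊗_ℤ ℂ`. -/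
noncomputable def value (R : Type*) [CommRing R] (g : G) : Irr G R →+* R ⊗[ℤ] ℂ :=
  (Algebra.TensorProduct.map (AlgHom.id ℤ R)
    ((Pi.evalRingHom (fun _ : G => ℂ) g).comp (ZIrr G).subtype).toIntAlgHom).toRingHom

/-- `e ∈ R Irr(G)` is, as a function on `G`, the characteristic function of `S`. -/
def IsCharFun {R : Type*} [CommRing R] (S : Set G) (e : Irr G R) : Prop :=
  (∀ g ∈ S, value R g e = 1) ∧ (∀ g ∉ S, value R g e = 0)

/-- When `R` is a domain of characteristic zero, an element of `R Irr(G)` is determined by its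
values, that is, `R Irr(G)` is a ring of functions on `G`. -/
theorem eq_of_value_eq [Finite G] {R : Type*} [CommRing R] [IsDomain R] [CharZero R]
    {a b : Irr G R} (h : ∀ g, value R g a = value R g b) : a = b := by
  classical
  cases nonempty_fintype G
  have hinj : Function.Injective
      (LinearMap.lTensor R (ZIrr G).subtype.toIntAlgHom.toLinearMap) :=
    Module.Flat.lTensor_preserves_injective_linearMap _ Subtype.val_injective
  apply hinj
  apply (TensorProduct.piRight ℤ ℤ R (fun _ : G => ℂ)).injective
  have key : ∀ (x : Irr G R) (g : G), TensorProduct.piRight ℤ ℤ R (fun _ : G => ℂ)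
      (LinearMap.lTensor R (ZIrr G).subtype.toIntAlgHom.toLinearMap x) g = value R g x := by
    intro x g
    refine TensorProduct.induction_on (motive := fun x => TensorProduct.piRight ℤ ℤ R
      (fun _ : G => ℂ) (LinearMap.lTensor R (ZIrr G).subtype.toIntAlgHom.toLinearMap x) g =
        value R g x) x ?_ (fun r f => rfl) ?_
    · rw [map_zero, map_zero, Pi.zero_apply]
      exact (map_zero (value R g)).symm
    · intro x y hx hy
      rw [map_add, map_add, Pi.add_apply, hx, hy]
      exact (map_add (value R g) x y).symm
  funext g
  rw [key, key, h]

theorem IsCharFun.isIdempotentElem [Finite G] {R : Type*} [CommRing R] [IsDomain R] [CharZero R]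
    {S : Set G} {e : Irr G R} (he : IsCharFun S e) : IsIdempotentElem e := by
  apply eq_of_value_eq
  intro g
  rw [map_mul]
  by_cases hg : g ∈ S
  · rw [he.1 g hg, one_mul]
  · rw [he.2 g hg, zero_mul]

/-- The set `G_p` of `p`-elements of `G`. -/
def pElements (p : ℕ) (G : Type) [Group G] : Set G := {g | ∃ k : ℕ, orderOf g = p ^ k}

end Ring

section Block

variable (O : Type*) [CommRing O] [IsDomain O] [CharZero O] (p : ℕ) (G : Type) [Group G]

open Classical in
/-- The characteristic function of `G_p`, as an element of `O Irr(G)`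
(and `0` if `O Irr(G)` does not contain this function). -/
noncomputable def principalIdempotent : Irr G O :=
  if h : ∃ e : Irr G O, IsCharFun (pElements p G) e then h.choose else 0

theorem principalIdempotent_isIdempotentElem [Finite G] :
    IsIdempotentElem (principalIdempotent O p G) := by
  unfold principalIdempotent
  split_ifs with h
  · exact h.choose_spec.isIdempotentElem
  · exact IsIdempotentElem.zero

variable [IsLocalRing O]

/-- Reduction `O Irr(G) → F Irr(G)` modulo the maximal ideal of `O`, where `F` is the residue field
of `O`. -/
noncomputable def reduction : Irr G O →+* Irr G (IsLocalRing.ResidueField O) :=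
  Irr.map G (IsLocalRing.residue O)

/-- The principal block `B_p(G) = F Irr(G) e`, where `e` is the reduction of the characteristic
function of `G_p`; this is a ring with identity element `e`. -/
abbrev PrincipalBlock [Finite G] : Type _ :=
  ((principalIdempotent_isIdempotentElem O p G).map (reduction O G)).Corner

end Block

/-- The Loewy length of a (commutative artinian) ring: the least `n` such that the `n`-th power of
the Jacobson radical vanishes. -/
noncomputable def loewyLength (B : Type*) [CommRing B] : ℕ :=
  sInf {n : ℕ | Ring.jacobson B ^ n = ⊥}

/-! ### The groups `(C₈ × C₈) ⋊ C₃ ⋊ C₄` -/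

section Groups

/-- The homomorphism from the cyclic group of order `n` that maps the generator to `x`, where
`x ^ n = 1`. -/
def cyclicHom {M : Type*} [Monoid M] (n : ℕ) [NeZero n] (x : M) (hx : x ^ n = 1) :
    Multiplicative (ZMod n) →* M where
  toFun i := x ^ (Multiplicative.toAdd i).val
  map_one' := by simp
  map_mul' i j := by
    rw [toAdd_mul, ZMod.val_add, ← pow_add]
    conv_rhs => rw [← Nat.div_add_mod ((Multiplicative.toAdd i).val +
      (Multiplicative.toAdd j).val) n, pow_add, pow_mul, hx, one_pow, one_mul]

/-- `C₈ × C₈`, written additively; it is identified with the ring `ℤ[ω]/(8)`, where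
`ω ^ 2 + ω + 1 = 0`, by letting `(x, y)` stand for `x + y ω`. -/
abbrev A : Type := ZMod 8 × ZMod 8

/-- Multiplication by `ω`, an automorphism of order `3` of `C₈ × C₈`. -/
def zAdd : A ≃+ A where
  toFun v := (-v.2, v.1 - v.2)
  invFun v := (v.2 - v.1, -v.1)
  left_inv v := by ext <;> simp
  right_inv v := by ext <;> simp
  map_add' v w := by ext <;> simp <;> ring

/-- `v ↦ (s - ω) * conj v`, an automorphism of `C₈ × C₈` whose square is multiplication by
`(s - ω) * conj (s - ω) = s ^ 2 + s + 1`. -/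
def tAdd (s : ZMod 8) : A ≃+ A where
  toFun v := (s * v.1 - (s + 1) * v.2, -v.1 - s * v.2)
  invFun v := ((s ^ 2 + s + 1) * (s * v.1 - (s + 1) * v.2), (s ^ 2 + s + 1) * (-v.1 - s * v.2))
  left_inv := by
    have h : (s ^ 2 + s + 1) * (s ^ 2 + s + 1) = 1 := by revert s; decide
    intro v
    ext
    · linear_combination v.1 * h
    · linear_combination v.2 * h
  right_inv := by
    have h : (s ^ 2 + s + 1) * (s ^ 2 + s + 1) = 1 := by revert s; decide
    intro v
    ext
    · linear_combination v.1 * h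
    · linear_combination v.2 * h
  map_add' v w := by ext <;> simp <;> ring

/-- `zAdd` as an automorphism of the multiplicatively written group. -/
def zAut : MulAut (Multiplicative A) := AddEquiv.toMultiplicative zAdd

/-- `tAdd` as an automorphism of the multiplicatively written group. -/
def tAut (s : ZMod 8) : MulAut (Multiplicative A) := AddEquiv.toMultiplicative (tAdd s)

theorem zAut_apply (v : Multiplicative A) :
    zAut v = Multiplicative.ofAdd (-v.toAdd.2, v.toAdd.1 - v.toAdd.2) := rfl

theorem tAut_apply (s : ZMod 8) (v : Multiplicative A) :
    tAut s v = Multiplicative.ofAdd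
      (s * v.toAdd.1 - (s + 1) * v.toAdd.2, -v.toAdd.1 - s * v.toAdd.2) := rfl

theorem zAut_pow : zAut ^ 3 = 1 := by
  ext v
  · simp only [pow_succ, pow_zero, one_mul, MulAut.mul_apply, zAut_apply, toAdd_ofAdd,
      MulAut.one_apply]
    ring
  · simp only [pow_succ, pow_zero, one_mul, MulAut.mul_apply, zAut_apply, toAdd_ofAdd,
      MulAut.one_apply]
    ring

theorem tAut_pow (s : ZMod 8) : tAut s ^ 4 = 1 := by
  have h : (s ^ 2 + s + 1) * (s ^ 2 + s + 1) = 1 := by revert s; decide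
  ext v
  · simp only [pow_succ, pow_zero, one_mul, MulAut.mul_apply, tAut_apply, toAdd_ofAdd,
      MulAut.one_apply]
    linear_combination v.toAdd.1 * h
  · simp only [pow_succ, pow_zero, one_mul, MulAut.mul_apply, tAut_apply, toAdd_ofAdd,
      MulAut.one_apply]
    linear_combination v.toAdd.2 * h

theorem tAut_zAut (s : ZMod 8) : tAut s * zAut = zAut⁻¹ * tAut s := by
  rw [eq_inv_mul_iff_mul_eq]
  ext v
  · simp only [MulAut.mul_apply, tAut_apply, zAut_apply, toAdd_ofAdd]
    ring
  · simp only [MulAut.mul_apply, tAut_apply, zAut_apply, toAdd_ofAdd]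
    ring

/-- The action of `C₃` on `C₈ × C₈` in which the generator acts as `zAut`. -/
def actC3 : Multiplicative (ZMod 3) →* MulAut (Multiplicative A) := cyclicHom 3 zAut zAut_pow

/-- The group `(C₈ × C₈) ⋊ C₃`. -/
abbrev N : Type := Multiplicative A ⋊[actC3] Multiplicative (ZMod 3)

theorem tAut_actC3 (s : ZMod 8) (i : Multiplicative (ZMod 3)) :
    tAut s * actC3 i = actC3 i⁻¹ * tAut s := by
  rw [map_inv]
  change tAut s * zAut ^ _ = (zAut ^ _)⁻¹ * tAut s
  rw [← inv_pow]
  exact (SemiconjBy.pow_right (show SemiconjBy (tAut s) zAut zAut⁻¹ from tAut_zAut s) _).eq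

/-- The automorphism of `(C₈ × C₈) ⋊ C₃` that acts on `C₈ × C₈` as `tAut s` and inverts `C₃`. -/
def tN (s : ZMod 8) : MulAut N where
  toFun g := ⟨tAut s g.left, g.right⁻¹⟩
  invFun g := ⟨(tAut s)⁻¹ g.left, g.right⁻¹⟩
  left_inv g := by ext1 <;> simp
  right_inv g := by ext1 <;> simp
  map_mul' g h := by
    have := DFunLike.congr_fun (tAut_actC3 s g.right) h.left
    simp only [MulAut.mul_apply] at this
    ext1
    · simp only [SemidirectProduct.mul_left, map_mul, this]
    · simp only [SemidirectProduct.mul_right, mul_inv]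

theorem tN_pow (s : ZMod 8) : tN s ^ 4 = 1 := by
  ext1 g
  ext1
  · exact DFunLike.congr_fun (tAut_pow s) g.left
  · change g.right⁻¹⁻¹⁻¹⁻¹ = g.right
    simp

/-- The group `(C₈ × C₈) ⋊ C₃ ⋊ C₄` in which the generator of `C₃` acts on `C₈ × C₈ = ℤ[ω]/(8)` as
multiplication by `ω`, and the generator of `C₄` inverts `C₃` and acts on `C₈ × C₈` as
`v ↦ (s - ω) * conj v`. -/
abbrev C8C3C4 (s : ZMod 8) : Type := N ⋊[cyclicHom 4 (tN s) (tN_pow s)] Multiplicative (ZMod 4)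

instance finite_semidirectProduct {K H : Type*} [Group K] [Group H] (φ : H →* MulAut K) [Finite K] [Finite H] :
    Finite (K ⋊[φ] H) :=
  Finite.of_equiv _ SemidirectProduct.equivProd.symm

end Groups

end CharacterRing

/-! Let `Q` be a Sylow 2-subgroup, of index 1 or 3 in the group `G`, and let π be the character of
`G` induced from the trivial character of `Q`. A 2-element fixes an odd number of cosets of `Q` and
any other element fixes none, so π has the values 1 and 3 on the 2-elements and 0 elsewhere. Hence
(4π - π²)/3 is the characteristic function of the 2-elements, and the block idempotent `e` is π²
modulo 2. The projection formula π f = Ind(Res f), together with Res π² ≡ 1 modulo 2, shows that `e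
f` vanishes modulo 2 exactly when Res f is divisible by 2. The block is local, and its radical comes
from the generalized characters of even degree. So `loewyLength_principalBlock` reduces Loewy length
`n + 1` to two facts about the ideal of even degrees: its power `n + 1` restricts into 2 ℤIrr(Q),
and its power `n` contains an element whose restriction has odd multiplicity of the trivial
character.

Here `Q = A ⋊ ⟨t⟩` is `C8C4 s`. Its character ring is additively generated by the characters τᵏ,
τᵏμ, τᵏψ, which are trivial on 2A, and by the characters induced from the λ_p with 2p ≠ 0
(`exists_isPeriodic`, `IsPeriodic.exists_eq`). So the ideal of even degrees is generated by 2, τ -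
1, μ - 1, ψ and induced characters. Restrictions from the big group are moreover invariant under `z`
on A and on At². This forces them into the smaller ideal generated by 2, τ - 1, μ - 1 + ψ and
`z`-orbit sums of induced characters (`IsStable.mem_stableIdeal`). This loss of generators is what
makes the two Loewy lengths differ.

Upper bounds: by `pow_le_span_two`, if the non-induced generators have vanishing `n + 1`-st power
modulo 2 and the restriction of the whole ideal to A has vanishing `n`-th power modulo 2, then the
whole ideal has vanishing `n + 1`-st power modulo 2. The first condition follows from the relations
between τ, μ and ψ. The second is a finite computation in the group algebra of A over the field with
two elements: all generators lie in an ideal generated by two orbit sums, whose monomials of degree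
`n` vanish. Here `n = 5` for `bigIdeal` and `n = 4` for `stableIdeal`.

Lower bounds: for `Q`, a product of five induced characters contains the trivial character an odd
number of times (`exists_odd_avg`). For the big group, the witness is (τ - 1)³ times a permutation
character of degree 192 (`exists_odd_avg_res`). Finally, a Sylow 2-subgroup is self-normalizing,
being a non-normal subgroup of prime index 3. -/

namespace CharacterRing

/-! ### Restriction, induction, degrees and averages of generalized characters -/

section General

variable {G H Q : Type} [Group G] [Group H] [Group Q]

theorem mem_ZIrr_of_mem_characters {f : G → ℂ} (hf : f ∈ characters G) : f ∈ ZIrr G :=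
  AddSubgroup.subset_closure hf

/-- To prove an additive property of all generalized characters, it suffices to prove it for
characters. -/
theorem ZIrr_induction {p : (G → ℂ) → Prop} (h : ∀ f ∈ characters G, p f) (h0 : p 0)
    (hadd : ∀ f g, p f → p g → p (f + g)) (hneg : ∀ f, p f → p (-f)) {f : G → ℂ}
    (hf : f ∈ ZIrr G) : p f :=
  AddSubgroup.closure_induction (p := fun f _ => p f) h h0 (fun f g _ _ => hadd f g)
    (fun f _ => hneg f) hf

theorem apply_conj {f : G → ℂ} (hf : f ∈ ZIrr G) (g h : G) : f (h * g * h⁻¹) = f g := by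
  revert g h
  refine ZIrr_induction (p := fun f => ∀ g h, f (h * g * h⁻¹) = f g) ?_ ?_ ?_ ?_ hf
  · rintro _ ⟨V, _, _, _, ρ, rfl⟩ g h
    exact Representation.char_conj ρ g h
  · simp
  · intro f f' h h' g x
    simp [h, h']
  · intro f h g x
    simp [h]

theorem apply_isConj {f : G → ℂ} (hf : f ∈ ZIrr G) {g h : G} (hgh : IsConj g h) : f g = f h := by
  obtain ⟨c, rfl⟩ := isConj_iff.1 hgh
  exact (apply_conj hf g c).symm

theorem comp_mem_ZIrr (φ : H →* G) {f : G → ℂ} (hf : f ∈ ZIrr G) : f ∘ φ ∈ ZIrr H := by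
  refine ZIrr_induction (p := fun f => f ∘ φ ∈ ZIrr H) ?_ ?_ ?_ ?_ hf
  · rintro _ ⟨V, _, _, _, ρ, rfl⟩
    exact mem_ZIrr_of_mem_characters ⟨V, inferInstance, inferInstance, inferInstance,
      MonoidHom.comp ρ φ, rfl⟩
  · exact zero_mem (ZIrr H)
  · intro f g hf hg
    exact add_mem hf hg
  · intro f hf
    exact neg_mem hf

/-- Restriction of generalized characters along a group homomorphism. -/
def res (φ : H →* G) : ZIrr G →+* ZIrr H where
  toFun f := ⟨f.1 ∘ φ, comp_mem_ZIrr φ f.2⟩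
  map_one' := rfl
  map_mul' _ _ := rfl
  map_zero' := rfl
  map_add' _ _ := rfl

@[simp]
theorem res_apply (φ : H →* G) (f : ZIrr G) (h : H) : (res φ f).1 h = f.1 (φ h) := rfl

/-- A homomorphism to the multiplicative monoid of `ℂ` is a linear character. -/
theorem hom_mem_ZIrr (χ : G →* ℂ) : (fun g => χ g) ∈ ZIrr G := by
  refine mem_ZIrr_of_mem_characters ⟨ℂ, inferInstance, inferInstance, inferInstance,
    { toFun := fun g => χ g • LinearMap.id, map_one' := ?_, map_mul' := ?_ }, ?_⟩
  · simp [Module.End.one_eq_id]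
  · intro g h
    ext
    simp [mul_comm]
  · ext g
    simp [Representation.character]

/-- A linear character as an element of the character ring. -/
def linearChar (χ : G →* ℂ) : ZIrr G := ⟨fun g => χ g, hom_mem_ZIrr χ⟩

theorem exists_int_apply_one {f : G → ℂ} (hf : f ∈ ZIrr G) : ∃ n : ℤ, f 1 = n := by
  refine ZIrr_induction (p := fun f => ∃ n : ℤ, f 1 = n) ?_ ?_ ?_ ?_ hf
  · rintro _ ⟨V, _, _, _, ρ, rfl⟩
    exact ⟨Module.finrank ℂ V, by simp⟩
  · exact ⟨0, by simp⟩
  · rintro f g ⟨n, hn⟩ ⟨m, hm⟩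
    exact ⟨n + m, by simp [hn, hm]⟩
  · rintro f ⟨n, hn⟩
    exact ⟨-n, by simp [hn]⟩

/-- The degree of a generalized character. -/
noncomputable def deg : ZIrr G →+* ℤ where
  toFun f := (exists_int_apply_one f.2).choose
  map_one' := by
    have := (exists_int_apply_one (1 : ZIrr G).2).choose_spec
    change (1 : ℂ) = _ at this
    exact_mod_cast this.symm
  map_zero' := by
    have := (exists_int_apply_one (0 : ZIrr G).2).choose_spec
    change (0 : ℂ) = _ at this
    exact_mod_cast this.symm
  map_mul' f g := by
    have h := (exists_int_apply_one (f * g).2).choose_spec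
    have hf := (exists_int_apply_one f.2).choose_spec
    have hg := (exists_int_apply_one g.2).choose_spec
    change f.1 1 * g.1 1 = _ at h
    rw [hf, hg] at h
    exact_mod_cast h.symm
  map_add' f g := by
    have h := (exists_int_apply_one (f + g).2).choose_spec
    have hf := (exists_int_apply_one f.2).choose_spec
    have hg := (exists_int_apply_one g.2).choose_spec
    change f.1 1 + g.1 1 = _ at h
    rw [hf, hg] at h
    exact_mod_cast h.symm

theorem deg_spec (f : ZIrr G) : f.1 1 = (deg f : ℤ) := (exists_int_apply_one f.2).choose_spec

theorem deg_eq_iff {f : ZIrr G} {n : ℤ} : deg f = n ↔ f.1 1 = n := by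
  rw [deg_spec]
  norm_cast

@[simp]
theorem deg_res (φ : H →* G) (f : ZIrr G) : deg (res φ f) = deg f := by
  rw [deg_eq_iff, res_apply, map_one, deg_spec]

section Average

variable [Fintype G]

theorem exists_int_sum_eq {f : G → ℂ} (hf : f ∈ ZIrr G) :
    ∃ n : ℤ, ∑ g, f g = Nat.card G * n := by
  refine ZIrr_induction (p := fun f => ∃ n : ℤ, ∑ g, f g = Nat.card G * n) ?_ ?_ ?_ ?_ hf
  · rintro _ ⟨V, _, _, _, ρ, rfl⟩
    have hne : (Nat.card G : ℂ) ≠ 0 := by simp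
    have : Invertible (Nat.card G : ℂ) := invertibleOfNonzero hne
    refine ⟨Module.finrank ℂ ρ.invariants, ?_⟩
    have := Representation.card_inv_mul_sum_char_eq_finrank ρ
    rw [inv_mul_eq_iff_eq_mul₀ hne] at this
    simpa using this
  · exact ⟨0, by simp⟩
  · rintro f g ⟨n, hn⟩ ⟨m, hm⟩
    exact ⟨n + m, by simp [Finset.sum_add_distrib, hn, hm, mul_add]⟩
  · rintro f ⟨n, hn⟩
    exact ⟨-n, by simp [hn]⟩

/-- The average of a generalized character, that is, its inner product with the trivial
character. -/
noncomputable def avg : ZIrr G →+ ℤ :=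
  AddMonoidHom.mk' (fun f => (exists_int_sum_eq f.2).choose) fun f g => by
    have h := (exists_int_sum_eq (f + g).2).choose_spec
    have hf := (exists_int_sum_eq f.2).choose_spec
    have hg := (exists_int_sum_eq g.2).choose_spec
    have hne : (Nat.card G : ℂ) ≠ 0 := by simp
    change ∑ x, (f.1 x + g.1 x) = _ at h
    rw [Finset.sum_add_distrib, hf, hg, ← mul_add, mul_right_inj' hne] at h
    exact_mod_cast h.symm

theorem avg_spec (f : ZIrr G) : ∑ g, f.1 g = Nat.card G * (avg f : ℤ) :=
  (exists_int_sum_eq f.2).choose_spec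

theorem avg_eq_iff {f : ZIrr G} {n : ℤ} : avg f = n ↔ ∑ g, f.1 g = Nat.card G * (n : ℂ) := by
  have hne : (Nat.card G : ℂ) ≠ 0 := by simp
  rw [avg_spec, mul_right_inj' hne]
  norm_cast

end Average

/-! ### Induction -/

/-- Only diagonal blocks contribute to the trace: split `L` along the coordinate projections and use
cyclicity of the trace in each summand. -/
theorem trace_pi {ι V : Type} [Fintype ι] [DecidableEq ι] [AddCommGroup V] [Module ℂ V]
    [FiniteDimensional ℂ V] (L : (ι → V) →ₗ[ℂ] (ι → V)) :
    LinearMap.trace ℂ _ L = ∑ i, LinearMap.trace ℂ V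
      (LinearMap.proj i ∘ₗ L ∘ₗ LinearMap.single ℂ (fun _ => V) i) := by
  have h : L = ∑ i, (L ∘ₗ LinearMap.single ℂ (fun _ => V) i) ∘ₗ LinearMap.proj i := by
    apply LinearMap.ext
    intro v
    simp only [LinearMap.sum_apply, LinearMap.comp_apply, LinearMap.proj_apply,
      LinearMap.coe_single]
    rw [← map_sum, Finset.univ_sum_single]
  conv_lhs => rw [h, map_sum]
  exact Finset.sum_congr rfl fun i _ => LinearMap.trace_comp_comm' _ _

/-- A permutation action of `G` on `ι` together with a cocycle with values in `Q`, along which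
characters of `Q` can be induced to `G`. -/
structure InductionData (Q G ι : Type) [Group Q] [Group G] where
  /-- the permutation action -/
  act : G →* Equiv.Perm ι
  /-- the cocycle -/
  c : G → ι → Q
  c_mul : ∀ g h i, c (g * h) i = c g (act h i) * c h i

namespace InductionData

variable {ι : Type} (D : InductionData Q G ι)

theorem c_one (i : ι) : D.c 1 i = 1 := by
  have := D.c_mul 1 1 i
  simpa using this

/-- The representation of `G` that is induced by a representation of `Q`. -/
def rep {V : Type} [AddCommGroup V] [Module ℂ V] (ρ : Representation ℂ Q V) :
    Representation ℂ G (ι → V) where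
  toFun g := LinearMap.pi fun i =>
    ρ (D.c g ((D.act g)⁻¹ i)) ∘ₗ LinearMap.proj ((D.act g)⁻¹ i)
  map_one' := by
    ext v i
    simp [c_one]
  map_mul' g h := by
    refine LinearMap.ext fun v => funext fun i => ?_
    simp [D.c_mul, mul_inv_rev]

variable [Fintype ι] [DecidableEq ι]

/-- The induced class function. -/
def indFun (f : Q → ℂ) (g : G) : ℂ := ∑ i, if D.act g i = i then f (D.c g i) else 0

/-- The diagonal block of `g` at `i` is ρ applied to the cocycle if `g` fixes `i`, and is zero
otherwise. -/
theorem character_rep {V : Type} [AddCommGroup V] [Module ℂ V] [FiniteDimensional ℂ V]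
    (ρ : Representation ℂ Q V) : (D.rep ρ).character = D.indFun ρ.character := by
  ext g
  rw [Representation.character, trace_pi, indFun]
  refine Finset.sum_congr rfl fun i _ => ?_
  split_ifs with h
  · have h' : (Equiv.symm (D.act g)) i = i := by rw [Equiv.symm_apply_eq, h]
    rw [Representation.character]
    congr 1
    ext v
    simp [rep, h']
  · have h' : (Equiv.symm (D.act g)) i ≠ i := by
      rw [Ne, Equiv.symm_apply_eq]
      exact fun h' => h h'.symm
    convert LinearMap.map_zero (LinearMap.trace ℂ V)
    ext v
    simp [rep, h']

theorem indFun_mem {f : Q → ℂ} (hf : f ∈ ZIrr Q) : D.indFun f ∈ ZIrr G := by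
  refine ZIrr_induction (p := fun f => D.indFun f ∈ ZIrr G) ?_ ?_ ?_ ?_ hf
  · rintro _ ⟨V, _, _, _, ρ, rfl⟩
    exact mem_ZIrr_of_mem_characters ⟨ι → V, inferInstance, inferInstance, inferInstance,
      D.rep ρ, (D.character_rep ρ).symm⟩
  · convert zero_mem (ZIrr G)
    ext g
    simp [indFun]
  · intro f g hf hg
    convert add_mem hf hg
    ext x
    simp only [indFun, Pi.add_apply, ← Finset.sum_add_distrib]
    refine Finset.sum_congr rfl fun i _ => ?_
    split_ifs <;> simp
  · intro f hf
    convert neg_mem hf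
    ext x
    simp only [indFun, Pi.neg_apply, ← Finset.sum_neg_distrib]
    refine Finset.sum_congr rfl fun i _ => ?_
    split_ifs <;> simp

/-- Induction of generalized characters. -/
def ind : ZIrr Q →+ ZIrr G :=
  AddMonoidHom.mk' (fun f => ⟨D.indFun f.1, D.indFun_mem f.2⟩) fun f g => by
    ext x
    change D.indFun (f.1 + g.1) x = D.indFun f.1 x + D.indFun g.1 x
    rw [indFun, indFun, indFun, ← Finset.sum_add_distrib]
    refine Finset.sum_congr rfl fun i _ => ?_
    split_ifs <;> simp

theorem ind_apply (f : ZIrr Q) (g : G) :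
    (D.ind f).1 g = ∑ i, if D.act g i = i then f.1 (D.c g i) else 0 := rfl

/-- The projection formula. -/
theorem ind_mul_res {j : Q →* G} (hj : ∀ g i, D.act g i = i → IsConj (j (D.c g i)) g)
    (a : ZIrr Q) (b : ZIrr G) : D.ind (a * res j b) = D.ind a * b := by
  ext g
  change _ = (D.ind a).1 g * b.1 g
  rw [ind_apply, ind_apply, Finset.sum_mul]
  refine Finset.sum_congr rfl fun i _ => ?_
  split_ifs with h
  · change a.1 _ * b.1 (j _) = _
    rw [apply_isConj b.2 (hj g i h)]
  · rw [zero_mul]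

end InductionData

open Classical in
/-- The data for the induction along an injective homomorphism. -/
noncomputable def InductionData.ofInjective (j : Q →* G) (hj : Function.Injective j) :
    InductionData Q G (G ⧸ j.range) where
  act := MulAction.toPermHom G (G ⧸ j.range)
  -- The cocycle compares the chosen representatives of the cosets `i` and `g • i`.
  c g i := (MonoidHom.ofInjective hj).symm ⟨(g • i).out⁻¹ * g * i.out, by
    rw [mul_assoc, ← QuotientGroup.eq, QuotientGroup.out_eq', ← smul_eq_mul,
      ← MulAction.Quotient.smul_coe, QuotientGroup.out_eq']⟩
  c_mul g h i := by
    rw [← map_mul]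
    congr 1
    ext
    simp [mul_smul, mul_assoc]

theorem InductionData.isConj_ofInjective (j : Q →* G) (hj : Function.Injective j) (g : G)
    (i : G ⧸ j.range) (h : (InductionData.ofInjective j hj).act g i = i) :
    IsConj (j ((InductionData.ofInjective j hj).c g i)) g := by
  have h' : g • i = i := h
  have : j ((InductionData.ofInjective j hj).c g i) = (g • i).out⁻¹ * g * i.out := by
    change ((MonoidHom.ofInjective hj) ((MonoidHom.ofInjective hj).symm _) : G) = _
    rw [MulEquiv.apply_symm_apply]
  rw [this, h', isConj_iff]
  exact ⟨i.out, by group⟩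

end General

/-! ### The Loewy length of a local corner -/

section Corner

variable {S : Type*} [CommRing S] {e : S} (he : IsIdempotentElem e)

theorem corner_mul_val (b : he.Corner) : e * b.1 = b.1 :=
  ((Subsemigroup.mem_corner_iff he).1 b.2).1

/-- The projection of a commutative ring to a corner. -/
def toCorner : S →+* he.Corner where
  toFun x := ⟨e * x, (Subsemigroup.mem_corner_iff he).2
    ⟨by rw [← mul_assoc, he.eq], by rw [mul_right_comm, he.eq]⟩⟩
  map_one' := Subtype.ext (mul_one e)
  map_zero' := Subtype.ext (mul_zero e)
  map_mul' x y := Subtype.ext (by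
    change e * (x * y) = e * x * (e * y)
    rw [mul_mul_mul_comm, he.eq])
  map_add' x y := Subtype.ext (mul_add e x y)

/-- The restriction to a corner of a ring homomorphism that maps its identity element to `1`. -/
def cornerHom {F : Type*} [CommRing F] (d : S →+* F) (hd : d e = 1) : he.Corner →+* F where
  toFun b := d b.1
  map_one' := hd
  map_zero' := map_zero d
  map_mul' x y := map_mul d x.1 y.1
  map_add' x y := map_add d x.1 y.1

/-- The restriction δ of `d` to the corner has a maximal kernel, which `hup` makes nilpotent; hence
this kernel is the Jacobson radical. Multiplication by `e` maps the powers of the kernel of `d` to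
those of the kernel of δ, so `hup` and `hlow` locate the first power that vanishes. -/
theorem loewyLength_corner {F : Type*} [Field F] (d : S →+* F) (hd : Function.Surjective d)
    (hde : d e = 1) (n : ℕ) (hup : ∀ x ∈ RingHom.ker d ^ (n + 1), e * x = 0)
    (hlow : ∃ x ∈ RingHom.ker d ^ n, e * x ≠ 0) : loewyLength he.Corner = n + 1 := by
  set δ := cornerHom he d hde with hδ
  have hδs : Function.Surjective δ := by
    intro r
    obtain ⟨x, rfl⟩ := hd r
    refine ⟨toCorner he x, ?_⟩
    change d (e * x) = _
    rw [map_mul, hde, one_mul]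
  have hmax : (RingHom.ker δ).IsMaximal := RingHom.ker_isMaximal_of_surjective δ hδs
  have hval : ∀ m, ∀ b ∈ RingHom.ker δ ^ m, b.1 ∈ RingHom.ker d ^ m := by
    intro m
    induction m with
    | zero => intro b _; simp
    | succ m ih =>
      intro b hb
      rw [pow_succ] at hb ⊢
      refine Submodule.mul_induction_on hb ?_ ?_
      · intro x hx y hy
        exact Ideal.mul_mem_mul (ih x hx) hy
      · intro x y hx hy
        exact add_mem hx hy
  have hbot : RingHom.ker δ ^ (n + 1) = ⊥ := by
    rw [eq_bot_iff]
    intro b hb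
    have := hup _ (hval _ b hb)
    rw [corner_mul_val] at this
    exact Subtype.ext this
  have hne : RingHom.ker δ ^ n ≠ ⊥ := by
    obtain ⟨x, hx, hx0⟩ := hlow
    intro h
    have hle : RingHom.ker d ≤ (RingHom.ker δ).comap (toCorner he) := by
      intro y hy
      change d (e * y) = 0
      rw [map_mul, (RingHom.mem_ker).1 hy, mul_zero]
    have := Ideal.le_comap_pow _ n (Ideal.pow_right_mono hle n hx)
    rw [h] at this
    have h0 : toCorner he x = 0 := this
    exact hx0 (congrArg Subtype.val h0)
  have hJ : Ring.jacobson he.Corner = RingHom.ker δ := by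
    apply le_antisymm
    · rw [← Ideal.jacobson_bot]
      exact sInf_le ⟨bot_le, hmax⟩
    · refine le_trans ?_ (nilradical_le_jacobson _)
      intro b hb
      refine ⟨n + 1, ?_⟩
      have := Ideal.pow_mem_pow hb (n + 1)
      rw [hbot] at this
      exact this
  unfold loewyLength
  rw [hJ]
  apply le_antisymm
  · exact Nat.sInf_le hbot
  · refine le_csInf ⟨_, hbot⟩ ?_
    intro m hm
    by_contra hlt
    refine hne (eq_bot_iff.2 ?_)
    rw [← (show RingHom.ker δ ^ m = ⊥ from hm)]
    exact Ideal.pow_le_pow_right (by lia)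

end Corner

/-! ### Scalar extension -/

section Scalars

variable {G Q : Type} [Group G] [Group Q] (F : Type*) [CommRing F]

/-- The elements `r ⊗ f` of `F Irr(G)`. -/
def Irr.tmul (r : F) (f : ZIrr G) : Irr G F := r ⊗ₜ[ℤ] f

variable {F}

theorem Irr.induction {p : Irr G F → Prop} (h : ∀ r f, p (Irr.tmul F r f))
    (hadd : ∀ a b, p a → p b → p (a + b)) (a : Irr G F) : p a := by
  refine TensorProduct.induction_on (motive := p) a ?_ h hadd
  have := h 0 0
  unfold Irr.tmul at this
  rwa [TensorProduct.zero_tmul] at this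

theorem Irr.tmul_add (r : F) (f g : ZIrr G) :
    Irr.tmul F r (f + g) = Irr.tmul F r f + Irr.tmul F r g := TensorProduct.tmul_add _ _ _

theorem Irr.tmul_sub (r : F) (f g : ZIrr G) :
    Irr.tmul F r (f - g) = Irr.tmul F r f - Irr.tmul F r g := TensorProduct.tmul_sub _ _ _

theorem Irr.tmul_mul (r r' : F) (f g : ZIrr G) :
    Irr.tmul F (r * r') (f * g) = Irr.tmul F r f * Irr.tmul F r' g := 
  (Algebra.TensorProduct.tmul_mul_tmul _ _ _ _).symm

theorem Irr.tmul_intCast_mul (r : F) (n : ℤ) (f : ZIrr G) :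
    Irr.tmul F r ((n : ZIrr G) * f) = Irr.tmul F (n * r) f := by
  unfold Irr.tmul
  rw [← zsmul_eq_mul, ← zsmul_eq_mul, TensorProduct.smul_tmul]

theorem Irr.map_tmul {R R' : Type*} [CommRing R] [CommRing R'] (f : R →+* R') (r : R)
    (x : ZIrr G) : Irr.map G f (Irr.tmul R r x) = Irr.tmul R' (f r) x := rfl

theorem value_tmul (g : G) (r : F) (f : ZIrr G) :
    value F g (Irr.tmul F r f) = r ⊗ₜ[ℤ] (f.1 g) := rfl

variable (F)

/-- The inclusion `ℤ Irr(G) → F Irr(G)`. -/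
noncomputable def Irr.incl : ZIrr G →+* Irr G F where
  toFun f := Irr.tmul F 1 f
  map_one' := rfl
  map_zero' := TensorProduct.tmul_zero _ _
  map_mul' f g := by rw [← Irr.tmul_mul, one_mul]
  map_add' f g := Irr.tmul_add 1 f g

/-- The degree map with coefficients in `F`. -/
noncomputable def degF : Irr G F →+* F :=
  (Algebra.TensorProduct.lift (AlgHom.id ℤ F) ((Int.castRingHom F).comp deg).toIntAlgHom
    (fun _ _ => Commute.all _ _)).toRingHom

/-- The restriction map with coefficients in `F`. -/
noncomputable def resF (j : Q →* G) : Irr G F →+* Irr Q F :=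
  (Algebra.TensorProduct.map (AlgHom.id ℤ F) (res j).toIntAlgHom).toRingHom

/-- The average with coefficients in `F`. -/
noncomputable def avgF [Fintype G] : Irr G F →+ F :=
  ((TensorProduct.rid ℤ F).toLinearMap ∘ₗ
    TensorProduct.map LinearMap.id avg.toIntLinearMap).toAddMonoidHom

variable {F}

theorem degF_tmul (r : F) (f : ZIrr G) : degF F (Irr.tmul F r f) = r * (deg f : ℤ) := by
  change Algebra.TensorProduct.lift (AlgHom.id ℤ F) ((Int.castRingHom F).comp deg).toIntAlgHom _
    (r ⊗ₜ[ℤ] f) = _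
  simp

theorem avgF_tmul [Fintype G] (r : F) (f : ZIrr G) :
    avgF F (Irr.tmul F r f) = (avg f : ℤ) * r := by
  change TensorProduct.rid ℤ F (r ⊗ₜ[ℤ] avg f) = _
  simp

variable (G) in
/-- The ideal of the generalized characters of even degree. -/
noncomputable def evenIdeal : Ideal (ZIrr G) := (Ideal.span {(2 : ℤ)}).comap deg

theorem mem_evenIdeal {f : ZIrr G} : f ∈ evenIdeal G ↔ Even (deg f) := by
  rw [evenIdeal, Ideal.mem_comap, Ideal.mem_span_singleton, even_iff_two_dvd]

/-- Modulo the ideal on the right every element is a scalar, namely its degree, because `f - deg f`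
has degree 0. -/
theorem ker_degF_le : RingHom.ker (degF F) ≤ (evenIdeal G).map (Irr.incl F) := by
  have key : ∀ a : Irr G F, a - Irr.tmul F (degF F a) 1 ∈ (evenIdeal G).map (Irr.incl F) := by
    refine Irr.induction ?_ ?_
    · intro r f
      have h1 : Irr.tmul F r f - Irr.tmul F (degF F (Irr.tmul F r f)) 1 =
          Irr.tmul F r 1 * Irr.incl F (f - ((deg f : ℤ) : ZIrr G)) := by
        change _ = _ * Irr.tmul F 1 (f - ((deg f : ℤ) : ZIrr G))
        rw [← Irr.tmul_mul, one_mul, mul_one, Irr.tmul_sub, degF_tmul, mul_comm r,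
          ← Irr.tmul_intCast_mul, mul_one]
      rw [h1]
      refine Ideal.mul_mem_left _ _ (Ideal.mem_map_of_mem _ (mem_evenIdeal.2 ?_))
      simp
    · intro a b ha hb
      convert add_mem ha hb using 1
      rw [map_add]
      have : Irr.tmul F (degF F a + degF F b) (1 : ZIrr G) =
        Irr.tmul F (degF F a) 1 + Irr.tmul F (degF F b) 1 := TensorProduct.add_tmul _ _ _
      rw [this]
      ring
  intro a ha
  have := key a
  rw [RingHom.mem_ker.1 ha] at this
  have h0 : Irr.tmul F 0 (1 : ZIrr G) = 0 := TensorProduct.zero_tmul _ _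
  rwa [h0, sub_zero] at this

end Scalars

/-! ### The principal block of a group with a Sylow `2`-subgroup of index `1` or `3` -/

section Block

variable {G Q ι : Type} [Group G] [Group Q] [Fintype ι] [DecidableEq ι]
  (D : InductionData Q G ι) {j : Q →* G} (hj : ∀ g i, D.act g i = i → IsConj (j (D.c g i)) g)

namespace InductionData

theorem ind_one_apply (g : G) :
    (D.ind 1).1 g = ((Finset.univ.filter fun i => D.act g i = i).card : ℂ) := by
  rw [ind_apply, Finset.card_filter, Nat.cast_sum]
  refine Finset.sum_congr rfl fun i _ => ?_
  split_ifs
  · simp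
  · simp

-- An element with a fixed point is conjugate to an element of the image of the 2-group `Q`.
include hj in
theorem ind_one_eq_zero (hQ : IsPGroup 2 Q) {g : G} (hg : g ∉ pElements 2 G) :
    (D.ind 1).1 g = 0 := by
  rw [ind_one_apply, Nat.cast_eq_zero, Finset.card_eq_zero, Finset.filter_eq_empty_iff]
  intro i _ hi
  refine hg ?_
  obtain ⟨k, hk⟩ := IsPGroup.iff_orderOf.1 hQ (D.c g i)
  have hd : orderOf g ∣ 2 ^ k := by
    obtain ⟨x, hx⟩ := isConj_iff.1 (hj g i hi)
    apply orderOf_dvd_of_pow_eq_one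
    rw [← hx, conj_pow, ← map_pow, ← hk, pow_orderOf_eq_one]
    simp
  obtain ⟨m, -, hm⟩ := (Nat.dvd_prime_pow Nat.prime_two).1 hd
  exact ⟨m, hm⟩

/-- A 2-group acting on a set of odd size has an odd number of fixed points. -/
theorem ind_one_eq (hι : Fintype.card ι = 1 ∨ Fintype.card ι = 3) {g : G}
    (hg : g ∈ pElements 2 G) : (D.ind 1).1 g = 1 ∨ (D.ind 1).1 g = 3 := by
  obtain ⟨k, hk⟩ := hg
  let inst : MulAction (Subgroup.zpowers g) ι :=
    MulAction.compHom ι (D.act.comp (Subgroup.zpowers g).subtype)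
  have hp : IsPGroup 2 (Subgroup.zpowers g) := IsPGroup.of_card (n := k) (by
    rw [Nat.card_zpowers, hk])
  have hmod := hp.card_modEq_card_fixedPoints ι
  have hfix : Nat.card (MulAction.fixedPoints (Subgroup.zpowers g) ι) =
      (Finset.univ.filter fun i => D.act g i = i).card := by
    classical
    rw [Nat.card_eq_fintype_card, ← Set.toFinset_card]
    congr 1
    ext i
    simp only [Set.mem_toFinset, MulAction.mem_fixedPoints, Finset.mem_filter, Finset.mem_univ,
      true_and]
    constructor
    · intro h
      exact h ⟨g, Subgroup.mem_zpowers g⟩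
    · rintro h ⟨x, m, rfl⟩
      change D.act (g ^ m) i = i
      rw [map_zpow]
      exact Equiv.Perm.zpow_apply_eq_self_of_apply_eq_self h m
  rw [hfix, Nat.card_eq_fintype_card] at hmod
  rw [ind_one_apply]
  have hle : (Finset.univ.filter fun i => D.act g i = i).card ≤ Fintype.card ι :=
    Finset.card_le_univ _
  unfold Nat.ModEq at hmod
  have : (Finset.univ.filter fun i => D.act g i = i).card = 1 ∨
      (Finset.univ.filter fun i => D.act g i = i).card = 3 := by lia
  rcases this with h | h <;> simp [h]

end InductionData

variable (hQ : IsPGroup 2 Q) (hι : Fintype.card ι = 1 ∨ Fintype.card ι = 3)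
variable (O : Type*) [CommRing O] [IsDomain O] [CharZero O] [IsLocalRing O]
  [CharP (IsLocalRing.ResidueField O) 2]

omit [IsDomain O] [CharZero O] in
theorem isUnit_three : IsUnit (3 : O) := by
  rw [← IsLocalRing.residue_ne_zero_iff_isUnit, map_ofNat]
  have h2 : (2 : IsLocalRing.ResidueField O) = 0 := by
    exact_mod_cast CharP.cast_eq_zero (IsLocalRing.ResidueField O) 2
  have : (3 : IsLocalRing.ResidueField O) = 1 := by linear_combination h2
  rw [this]
  exact one_ne_zero

-- The polynomial 4x - x² has the value 3 at both 1 and 3, and 0 at 0.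
include hj hQ hι in
omit [IsDomain O] [CharZero O] [IsLocalRing O] [CharP (IsLocalRing.ResidueField O) 2] in
theorem isCharFun_tmul {u : O} (hu : 3 * u = 1) : IsCharFun (pElements 2 G)
    (Irr.tmul O u (4 * D.ind 1 - D.ind 1 * D.ind 1)) := by
  have hval : ∀ g, (4 * D.ind 1 - D.ind 1 * D.ind 1 : ZIrr G).1 g =
      4 * (D.ind 1).1 g - (D.ind 1).1 g * (D.ind 1).1 g := fun g => rfl
  constructor
  · intro g hg
    have h3 : (4 * D.ind 1 - D.ind 1 * D.ind 1 : ZIrr G).1 g = (3 : ℤ) • (1 : ℂ) := by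
      rw [hval]
      rcases D.ind_one_eq hι hg with h | h <;> rw [h] <;> norm_num
    rw [value_tmul, h3, ← TensorProduct.smul_tmul]
    simp [hu, Algebra.TensorProduct.one_def]
  · intro g hg
    rw [value_tmul, hval, D.ind_one_eq_zero hj hQ hg]
    simp

variable [Finite G]

include hj hQ hι in
theorem existsUnique_isCharFun : ∃! e : Irr G O, IsCharFun (pElements 2 G) e := by
  obtain ⟨u, hu⟩ := (isUnit_three O).exists_right_inv
  refine ⟨_, isCharFun_tmul D hj hQ hι O hu, ?_⟩
  intro e he
  apply eq_of_value_eq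
  intro g
  by_cases hg : g ∈ pElements 2 G
  · rw [he.1 g hg, (isCharFun_tmul D hj hQ hι O hu).1 g hg]
  · rw [he.2 g hg, (isCharFun_tmul D hj hQ hι O hu).2 g hg]

-- Modulo 2 the inverse of 3 becomes 1, and 4π - π² becomes π².
include hj hQ hι in
theorem reduction_principalIdempotent :
    reduction O G (principalIdempotent O 2 G) = Irr.incl _ (D.ind 1 * D.ind 1) := by
  obtain ⟨u, hu⟩ := (isUnit_three O).exists_right_inv
  have hex := existsUnique_isCharFun D hj hQ hι O
  have he : principalIdempotent O 2 G = Irr.tmul O u (4 * D.ind 1 - D.ind 1 * D.ind 1) := by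
    unfold principalIdempotent
    rw [dif_pos hex.exists]
    exact hex.unique hex.exists.choose_spec (isCharFun_tmul D hj hQ hι O hu)
  have h2 : (2 : IsLocalRing.ResidueField O) = 0 := by
    exact_mod_cast CharP.cast_eq_zero (IsLocalRing.ResidueField O) 2
  have hu' : IsLocalRing.residue O u = 1 := by
    have := congrArg (IsLocalRing.residue O) hu
    rw [map_mul, map_ofNat, map_one] at this
    linear_combination this - h2 * IsLocalRing.residue O u
  have h2' : (2 : Irr G (IsLocalRing.ResidueField O)) = 0 := by
    have : Irr.tmul (IsLocalRing.ResidueField O) 2 (1 : ZIrr G) = 2 := by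
      have h := Irr.tmul_intCast_mul (F := IsLocalRing.ResidueField O) 1 2 (1 : ZIrr G)
      norm_num at h
      rw [← h]
      exact map_ofNat (Irr.incl (G := G) (IsLocalRing.ResidueField O)) 2
    rw [← this, h2]
    exact TensorProduct.zero_tmul _ _
  rw [he, reduction, Irr.map_tmul, hu']
  change Irr.incl _ _ = _
  rw [map_sub, map_mul, map_mul, map_ofNat]
  linear_combination (2 * Irr.incl _ (D.ind 1) - Irr.incl _ (D.ind 1) * Irr.incl _ (D.ind 1)) * h2'

-- With π the induced trivial character, π² f = π Ind(Res f) is divisible by 2 as soon as Res f is.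
-- Conversely Res(π² f) ≡ Res f modulo 2, so an odd average of Res f certifies that `e f` is
-- nonzero.
include hj hQ hι in
theorem loewyLength_principalBlock [Fintype Q] (n : ℕ)
    (hup : evenIdeal G ^ (n + 1) ≤ (Ideal.span {2}).comap (res j))
    (hlow : ∃ f ∈ evenIdeal G ^ n, Odd (avg (res j f))) :
    loewyLength (PrincipalBlock O 2 G) = n + 1 := by
  have hred := reduction_principalIdempotent D hj hQ hι O
  have h2 : (2 : IsLocalRing.ResidueField O) = 0 := by
    exact_mod_cast CharP.cast_eq_zero (IsLocalRing.ResidueField O) 2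
  have hdeg : degF (IsLocalRing.ResidueField O) (Irr.incl _ (D.ind 1) : Irr G _) = 1 := by
    change degF _ (Irr.tmul _ 1 _) = 1
    rw [degF_tmul, one_mul]
    have : deg (D.ind 1) = Fintype.card ι := by
      rw [deg_eq_iff, D.ind_one_apply]
      simp
    rw [this]
    rcases hι with h | h <;> rw [h]
    · simp
    · push_cast
      linear_combination h2
  -- On `Q` the values of π are 1 and 3, the roots of x² - 4x + 3. In particular Res π² ≡ 1 modulo
  -- 2.
  have hres : res j (D.ind 1 * D.ind 1) = 4 * res j (D.ind 1) - 3 := by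
    ext q
    change (D.ind 1).1 (j q) * (D.ind 1).1 (j q) = 4 * (D.ind 1).1 (j q) - 3
    have hq : j q ∈ pElements 2 G := by
      obtain ⟨k, hk⟩ := IsPGroup.iff_orderOf.1 hQ q
      obtain ⟨m, -, hm⟩ := (Nat.dvd_prime_pow Nat.prime_two).1 (hk ▸ orderOf_map_dvd j q)
      exact ⟨m, hm⟩
    rcases D.ind_one_eq hι hq with h | h <;> rw [h] <;> norm_num
  have htwo : ∀ (K : Type) [Group K] (f : ZIrr K),
      Irr.incl (IsLocalRing.ResidueField O) (2 * f) = 0 := by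
    intro K _ f
    have := Irr.tmul_intCast_mul (F := IsLocalRing.ResidueField O) 1 2 f
    push_cast at this
    change Irr.tmul _ 1 _ = _
    rw [this, h2, zero_mul]
    exact TensorProduct.zero_tmul _ _
  refine loewyLength_corner _ (degF (IsLocalRing.ResidueField O)) ?_ ?_ n ?_ ?_
  · intro r
    exact ⟨Irr.tmul _ r 1, by rw [degF_tmul]; simp⟩
  · rw [hred, map_mul, map_mul, hdeg, one_mul]
  · intro x hx
    have hx' := Ideal.pow_right_mono ker_degF_le (n + 1) hx
    rw [← Ideal.map_pow] at hx'
    rw [hred]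
    refine Submodule.span_induction (p := fun x _ => Irr.incl _ (D.ind 1 * D.ind 1) * x = 0)
      ?_ ?_ ?_ ?_ hx'
    · rintro _ ⟨f, hf, rfl⟩
      obtain ⟨h, hh⟩ := Ideal.mem_span_singleton.1 (hup hf)
      have : D.ind 1 * D.ind 1 * f = 2 * (D.ind 1 * D.ind h) := by
        rw [mul_assoc, ← D.ind_mul_res hj 1 f, one_mul, hh, two_mul, map_add]
        ring
      change _ * Irr.incl _ f = 0
      rw [← map_mul, this, htwo]
    · exact mul_zero _
    · intro x y _ _ hx hy
      rw [mul_add, hx, hy, add_zero]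
    · intro a x _ hx
      rw [smul_eq_mul, mul_left_comm, hx, mul_zero]
  · obtain ⟨f, hf, m, hm⟩ := hlow
    refine ⟨Irr.incl _ f, ?_, ?_⟩
    · have hle : evenIdeal G ≤
          (RingHom.ker (degF (IsLocalRing.ResidueField O))).comap (Irr.incl _) := by
        intro y hy
        rw [Ideal.mem_comap, RingHom.mem_ker]
        change degF _ (Irr.tmul _ 1 _) = 0
        obtain ⟨k, hk⟩ := mem_evenIdeal.1 hy
        rw [degF_tmul, hk]
        push_cast
        linear_combination k * h2
      exact Ideal.le_comap_pow _ n (Ideal.pow_right_mono hle n hf)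
    · rw [hred, ← map_mul]
      intro h0
      have h1 := congrArg (fun a => avgF _ (resF _ j a)) h0
      have h3 : resF _ j (Irr.incl (IsLocalRing.ResidueField O) (D.ind 1 * D.ind 1 * f)) =
          Irr.incl (IsLocalRing.ResidueField O) (res j f) := by
        change Irr.incl _ (res j _) = _
        have : res j (D.ind 1 * D.ind 1 * f) =
            res j f + 2 * ((2 * res j (D.ind 1) - 2) * res j f) := by
          rw [map_mul, hres]
          ring
        rw [this, map_add, htwo, add_zero]
      simp only [h3, map_zero] at h1
      have h4 : avgF (IsLocalRing.ResidueField O) (Irr.incl _ (res j f)) = 1 := by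
        change avgF _ (Irr.tmul _ 1 _) = 1
        rw [avgF_tmul, hm]
        push_cast
        linear_combination m * h2
      rw [h4] at h1
      exact one_ne_zero h1

end Block

/-! ### Induction from the normal factor of a semidirect product -/

section Semidirect

variable {K H : Type} [Group K] [Group H] (φ : H →* MulAut K)

/-- The data for the induction from `K` to `K ⋊ H`. -/
def InductionData.semidirect : InductionData K (K ⋊[φ] H) H where
  act := (MulAction.toPermHom H H).comp SemidirectProduct.rightHom
  -- The elements of `H` are the coset representatives; this is `(g.right * i)⁻¹ * g * i`, computed
  -- in the semidirect product.
  c g i := φ (g.right * i)⁻¹ g.left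
  c_mul g h i := by
    simp only [SemidirectProduct.mul_left, SemidirectProduct.mul_right, map_mul]
    have hφ : ∀ (a b : H) (x : K), φ a (φ b x) = φ (a * b) x := fun a b x => by
      rw [map_mul, MulAut.mul_apply]
    rw [hφ]
    change _ = φ (g.right * (h.right * i))⁻¹ g.left * φ (h.right * i)⁻¹ h.left
    congr 3 <;> group

theorem InductionData.isConj_semidirect (g : K ⋊[φ] H) (i : H)
    (h : (InductionData.semidirect φ).act g i = i) :
    IsConj (SemidirectProduct.inl ((InductionData.semidirect φ).c g i)) g := by
  have h1 : g.right = 1 := by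
    have : g.right * i = i := h
    simpa using this
  rw [isConj_iff]
  refine ⟨SemidirectProduct.inr i, ?_⟩
  change SemidirectProduct.inr i * SemidirectProduct.inl (φ (g.right * i)⁻¹ g.left) *
    (SemidirectProduct.inr i)⁻¹ = g
  rw [h1]
  ext <;> simp [h1]

variable [Fintype H] [DecidableEq H]

theorem InductionData.ind_semidirect_apply (f : ZIrr K) (g : K ⋊[φ] H) :
    ((InductionData.semidirect φ).ind f).1 g =
      if g.right = 1 then ∑ i, f.1 (φ i g.left) else 0 := by
  rw [InductionData.ind_apply]
  split_ifs with h
  · rw [← Equiv.sum_comp (Equiv.inv H)]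
    refine Finset.sum_congr rfl fun i _ => ?_
    rw [if_pos]
    · change f.1 (φ (g.right * i⁻¹)⁻¹ g.left) = _
      simp [h]
    · change g.right * i⁻¹ = i⁻¹
      simp [h]
  · refine Finset.sum_eq_zero fun i _ => if_neg ?_
    change g.right * i ≠ i
    simpa using h

end Semidirect

/-! ### The Sylow `2`-subgroup -/

section SylowTwo

/-- The group `(C₈ × C₈) ⋊ C₄`, which is isomorphic to the Sylow `2`-subgroups of `C8C3C4 s`. -/
abbrev C8C4 (s : ZMod 8) : Type :=
  Multiplicative A ⋊[cyclicHom 4 (tAut s) (tAut_pow s)] Multiplicative (ZMod 4)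

/-- The action of the element `l` of `C₄` on `C₈ × C₈`. -/
def tPow (s : ZMod 8) (l : ZMod 4) (v : A) : A := (tAdd s)^[l.val] v

variable {s : ZMod 8}

theorem cyclicHom_tAut (l : ZMod 4) (v : A) :
    cyclicHom 4 (tAut s) (tAut_pow s) (Multiplicative.ofAdd l) (Multiplicative.ofAdd v) =
      Multiplicative.ofAdd (tPow s l v) := by
  change (tAut s ^ l.val) (Multiplicative.ofAdd v) = _
  unfold tPow
  generalize l.val = n
  induction n generalizing v with
  | zero => rfl
  | succ n ih =>
    rw [pow_succ, MulAut.mul_apply, Function.iterate_succ_apply]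
    exact ih _

/-- The element of `C8C4 s` with the given components. -/
def el (v : A) (l : ZMod 4) : C8C4 s := ⟨Multiplicative.ofAdd v, Multiplicative.ofAdd l⟩

theorem eq_el (g : C8C4 s) : ∃ v l, g = el v l := ⟨g.left.toAdd, g.right.toAdd, rfl⟩

theorem el_mul (v w : A) (l m : ZMod 4) :
    (el v l * el w m : C8C4 s) = el (v + tPow s l w) (l + m) := by
  unfold el
  rw [SemidirectProduct.mul_def]
  dsimp only
  rw [cyclicHom_tAut]
  rfl

theorem tPow_zero_left (v : A) : tPow s 0 v = v := rfl

theorem tPow_one_left (v : A) : tPow s 1 v = tAdd s v := rfl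

theorem tPow_zero_right (l : ZMod 4) : tPow s l 0 = 0 := by
  unfold tPow
  exact Function.iterate_fixed (map_zero (tAdd s)) _

/-! ### The linear characters of `C₈ × C₈` -/

/-- The pairing of `C₈ × C₈` with its dual group. -/
def pairing (p v : A) : ZMod 8 := p.1 * v.1 + p.2 * v.2

theorem pairing_add_right (p v w : A) : pairing p (v + w) = pairing p v + pairing p w := by
  simp [pairing]
  ring

theorem pairing_add_left (p q v : A) : pairing (p + q) v = pairing p v + pairing q v := by
  simp [pairing]
  ring

theorem pairing_neg_left (p v : A) : pairing (-p) v = -pairing p v := by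
  simp [pairing]
  ring

/-- The linear character of `C₈ × C₈` with parameter `p`. -/
noncomputable def lamHom (p : A) : Multiplicative A →* ℂ where
  toFun v := ZMod.stdAddChar (pairing p v.toAdd)
  map_one' := by simp [pairing]
  map_mul' v w := by
    rw [toAdd_mul, pairing_add_right, AddChar.map_add_eq_mul]

/-- The linear character of `C₈ × C₈` with parameter `p`, in the character ring. -/
noncomputable def lam (p : A) : ZIrr (Multiplicative A) := linearChar (lamHom p)

theorem lam_apply (p v : A) :
    (lam p).1 (Multiplicative.ofAdd v) = ZMod.stdAddChar (pairing p v) := rfl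

theorem lam_add (p q : A) : lam (p + q) = lam p * lam q := by
  ext v
  change ZMod.stdAddChar (pairing (p + q) v.toAdd) =
    ZMod.stdAddChar (pairing p v.toAdd) * ZMod.stdAddChar (pairing q v.toAdd)
  rw [pairing_add_left, AddChar.map_add_eq_mul]

theorem lam_zero : lam 0 = 1 := by
  ext v
  change ZMod.stdAddChar (pairing 0 v.toAdd) = 1
  simp [pairing]

theorem stdAddChar_four : (ZMod.stdAddChar (4 : ZMod 8) : ℂ) = -1 := by
  have h1 : (ZMod.stdAddChar (4 : ZMod 8) : ℂ) * ZMod.stdAddChar (4 : ZMod 8) = 1 := by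
    rw [← AddChar.map_add_eq_mul, show (4 + 4 : ZMod 8) = 0 by decide, AddChar.map_zero_eq_one]
  have h2 : (ZMod.stdAddChar (4 : ZMod 8) : ℂ) ≠ 1 := by
    rw [← AddChar.map_zero_eq_one (ZMod.stdAddChar (N := 8)), Ne,
      ZMod.injective_stdAddChar.eq_iff]
    decide
  rcases mul_self_eq_one_iff.1 h1 with h | h
  · exact absurd h h2
  · exact h

theorem sum_stdAddChar_pairing (v : A) :
    ∑ p : A, (ZMod.stdAddChar (pairing p v) : ℂ) = if v = 0 then 64 else 0 := by
  have h := AddChar.sum_mulShift (R := ZMod 8) (R' := ℂ) (ψ := ZMod.stdAddChar)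
  have h1 : ∑ p : A, (ZMod.stdAddChar (pairing p v) : ℂ) =
      (∑ a : ZMod 8, ZMod.stdAddChar (a * v.1)) * ∑ b : ZMod 8, ZMod.stdAddChar (b * v.2) := by
    rw [Fintype.sum_prod_type, Finset.sum_mul_sum]
    simp_rw [pairing, AddChar.map_add_eq_mul]
  rw [h1, h v.1 (ZMod.isPrimitive_stdAddChar 8), h v.2 (ZMod.isPrimitive_stdAddChar 8)]
  obtain ⟨a, b⟩ := v
  by_cases ha : a = 0 <;> by_cases hb : b = 0 <;> simp [ha, hb, ZMod.card]
  norm_num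

/-- The dual of the automorphism `tAdd s`. -/
def tDual (s : ZMod 8) (p : A) : A := (s * p.1 - p.2, -(s + 1) * p.1 - s * p.2)

theorem pairing_tAdd (p v : A) : pairing p (tAdd s v) = pairing (tDual s p) v := by
  simp only [pairing, tDual, tAdd, AddEquiv.coe_mk, Equiv.coe_fn_mk]
  ring

theorem pairing_iterate_tAdd (p v : A) (n : ℕ) :
    pairing p ((tAdd s)^[n] v) = pairing ((tDual s)^[n] p) v := by
  induction n generalizing p v with
  | zero => rfl
  | succ n ih =>
    rw [Function.iterate_succ_apply', pairing_tAdd, ih, Function.iterate_succ_apply]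

theorem pairing_tPow (p v : A) (l : ZMod 4) :
    pairing p (tPow s l v) = pairing ((tDual s)^[l.val] p) v := pairing_iterate_tAdd p v _

/-- The inclusion of `C₈ × C₈`. -/
abbrev inlA (s : ZMod 8) : Multiplicative A →* C8C4 s := SemidirectProduct.inl

/-- Induction from `C₈ × C₈` to `C8C4 s`. -/
noncomputable def indA (s : ZMod 8) : ZIrr (Multiplicative A) →+ ZIrr (C8C4 s) :=
  (InductionData.semidirect _).ind

theorem indA_mul_res (a : ZIrr (Multiplicative A)) (b : ZIrr (C8C4 s)) :
    indA s (a * res (inlA s) b) = indA s a * b :=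
  InductionData.ind_mul_res _ (InductionData.isConj_semidirect _) a b

theorem indA_apply_zero (a : ZIrr (Multiplicative A)) (v : A) :
    (indA s a).1 (el v 0) = ∑ l : ZMod 4, a.1 (Multiplicative.ofAdd (tPow s l v)) := by
  refine (InductionData.ind_semidirect_apply _ a _).trans ?_
  rw [if_pos (by rfl)]
  refine Fintype.sum_equiv Multiplicative.toAdd _ _ fun l => ?_
  exact congrArg a.1 (cyclicHom_tAut _ _)

theorem indA_apply_ne (a : ZIrr (Multiplicative A)) (v : A) {l : ZMod 4} (hl : l ≠ 0) :
    (indA s a).1 (el v l) = 0 :=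
  (InductionData.ind_semidirect_apply _ a _).trans (if_neg hl)

/-- Mackey's formula for a normal subgroup. The sum runs over the elements of `C₄`, so a short orbit
is counted with multiplicity. -/
theorem res_indA_lam (p : A) :
    res (inlA s) (indA s (lam p)) = ∑ l : ZMod 4, lam ((tDual s)^[l.val] p) := by
  ext v
  refine (indA_apply_zero (lam p) v.toAdd).trans ?_
  have : (∑ l : ZMod 4, lam ((tDual s)^[l.val] p)).1 v =
      ∑ l : ZMod 4, (lam ((tDual s)^[l.val] p)).1 v := by
    rw [AddSubmonoidClass.coe_finsetSum, Finset.sum_apply]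
  rw [this]
  refine Finset.sum_congr rfl fun l _ => ?_
  rw [lam_apply, pairing_tPow]
  rfl

/-! ### The characters `τ`, `μ` and `ψ` -/

/-- The linear character of order `4` with kernel `C₈ × C₈`. -/
noncomputable def tau (s : ZMod 8) : ZIrr (C8C4 s) :=
  linearChar ((cyclicHom 4 Complex.I Complex.I_pow_four).comp SemidirectProduct.rightHom)

theorem tau_apply (v : A) (l : ZMod 4) : (tau s).1 (el v l) = Complex.I ^ l.val := rfl

/-- The nontrivial `t`-invariant character of `C₈ × C₈` of order `2`. -/
def muDual (s : ZMod 8) : A := (4, 4 * s + 4)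

theorem tDual_muDual : tDual s (muDual s) = muDual s := by
  revert s
  decide

/-- The linear character of order `2` that extends the character `muDual s`. -/
noncomputable def mu (s : ZMod 8) : ZIrr (C8C4 s) :=
  linearChar
    { toFun := fun g => lamHom (muDual s) g.left
      map_one' := by simp
      map_mul' := by
        intro g h
        obtain ⟨v, l, rfl⟩ := eq_el g
        obtain ⟨w, m, rfl⟩ := eq_el h
        rw [el_mul]
        change ZMod.stdAddChar (pairing _ _) =
          ZMod.stdAddChar (pairing _ v) * ZMod.stdAddChar (pairing _ w)
        change ZMod.stdAddChar (pairing (muDual s) (v + tPow s l w)) = _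
        rw [pairing_add_right, AddChar.map_add_eq_mul, pairing_tPow,
          Function.iterate_fixed tDual_muDual] }

theorem mu_apply (v : A) (l : ZMod 4) :
    (mu s).1 (el v l) = ZMod.stdAddChar (pairing (muDual s) v) := rfl

/-- The two characters of order `2` of `C₈ × C₈` that are interchanged by `t`. -/
def psiDual (s : ZMod 8) (i : ZMod 2) : A := if i = 0 then (0, 4) else (4, 4 * s)

theorem tDual_psiDual (i : ZMod 2) : tDual s (psiDual s i) = psiDual s (i + 1) := by
  revert s i
  decide

theorem pairing_psiDual_tPow (i : ZMod 2) (l : ZMod 4) (v : A) :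
    pairing (psiDual s i) (tPow s l v) = pairing (psiDual s (i + l.cast)) v := by
  rw [pairing_tPow]
  have h : ∀ n : ℕ, (tDual s)^[n] (psiDual s i) = psiDual s (i + n) := by
    intro n
    induction n with
    | zero => simp
    | succ n ih =>
      rw [Function.iterate_succ_apply', ih, tDual_psiDual]
      congr 1
      push_cast
      ring
  rw [h, ZMod.natCast_val]

/-- The data for the induction of the characters `psiDual s i`. -/
def psiData (s : ZMod 8) : InductionData (Multiplicative (ZMod 8)) (C8C4 s) (ZMod 2) where
  act :=
    { toFun := fun g => Equiv.addRight (ZMod.castHom (show 2 ∣ 4 by decide) (ZMod 2) g.right.toAdd)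
      map_one' := by ext; simp
      map_mul' := by
        intro g h
        ext i
        simp only [SemidirectProduct.mul_right, toAdd_mul, map_add, Equiv.Perm.mul_apply,
          Equiv.coe_addRight]
        ring_nf }
  -- An element `v tˡ` first moves the line with index `i` to the one with index `i + l`, on which
  -- `v` then acts through the character `psiDual s (i + l)`.
  c g i := Multiplicative.ofAdd (pairing (psiDual s
    (i + ZMod.castHom (show 2 ∣ 4 by decide) (ZMod 2) g.right.toAdd)) g.left.toAdd)
  c_mul g h i := by
    obtain ⟨v, l, rfl⟩ := eq_el g
    obtain ⟨w, m, rfl⟩ := eq_el h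
    rw [el_mul, ← ofAdd_add]
    congr 1
    simp only [el, toAdd_ofAdd, MonoidHom.coe_mk, OneHom.coe_mk, Equiv.coe_addRight, map_add]
    rw [pairing_add_right, pairing_psiDual_tPow]
    have h1 : ∀ (i : ZMod 2) (l m : ZMod 4),
        i + ((l.cast : ZMod 2) + m.cast) + l.cast = i + m.cast := by decide
    have h2 : ∀ (i : ZMod 2) (l m : ZMod 4),
        i + ((l.cast : ZMod 2) + m.cast) = i + m.cast + l.cast := by decide
    simp only [ZMod.castHom_apply]
    rw [h1, h2]

/-- The character `x ↦ exp (2πix/8)` of the cyclic group of order `8`. -/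
noncomputable def stdHom : Multiplicative (ZMod 8) →* ℂ := (ZMod.stdAddChar (N := 8)).toMonoidHom

/-- The irreducible character of degree `2` that is trivial on `t ^ 2`. -/
noncomputable def psi (s : ZMod 8) : ZIrr (C8C4 s) := (psiData s).ind (linearChar stdHom)

theorem psi_apply (v : A) (l : ZMod 4) : (psi s).1 (el v l) =
    if l = 0 ∨ l = 2 then (ZMod.stdAddChar (pairing (psiDual s 0) v) : ℂ) +
      ZMod.stdAddChar (pairing (psiDual s 1) v) else 0 := by
  unfold psi
  rw [InductionData.ind_apply]
  change ∑ i : ZMod 2, (if i + (l.cast : ZMod 2) = i then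
    (ZMod.stdAddChar (pairing (psiDual s (i + (l.cast : ZMod 2))) v) : ℂ) else 0) = _
  have h : (l.cast : ZMod 2) = 0 ↔ l = 0 ∨ l = 2 := by revert l; decide
  split_ifs with hl
  · rw [h.2 hl]
    simp only [add_zero, if_true]
    exact Fin.sum_univ_two _
  · refine Finset.sum_eq_zero fun i _ => if_neg ?_
    rw [← h] at hl
    simpa using hl

theorem apply_tAdd (f : ZIrr (C8C4 s)) (v : A) (l : ZMod 4) :
    f.1 (el (tAdd s v) l) = f.1 (el v l) := by
  refine (apply_isConj f.2 (isConj_iff.2 ⟨el 0 1, ?_⟩)).symm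
  rw [mul_inv_eq_iff_eq_mul, el_mul, el_mul, tPow_zero_right, tPow_one_left, zero_add, add_zero,
    add_comm 1 l]

/-- Conjugation by `w`: on the coset of `tˡ`, a class function depends only on `v` modulo the image
of `1 - tˡ`. -/
theorem apply_add_sub (f : ZIrr (C8C4 s)) (v w : A) (l : ZMod 4) :
    f.1 (el (v + w - tPow s l w) l) = f.1 (el v l) := by
  refine (apply_isConj f.2 (isConj_iff.2 ⟨el w 0, ?_⟩)).symm
  rw [mul_inv_eq_iff_eq_mul, el_mul, el_mul, tPow_zero_left, add_zero, zero_add, sub_add_cancel,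
    add_comm]

end SylowTwo

/-! ### Class functions of `(C₈ × C₈) ⋊ C₄` that are constant on the cosets of `2 (C₈ × C₈)` -/

section Periodic

variable {G : Type} [Group G]

theorem val_mul (f g : ZIrr G) (x : G) : (f * g).1 x = f.1 x * g.1 x := rfl

theorem val_add (f g : ZIrr G) (x : G) : (f + g).1 x = f.1 x + g.1 x := rfl

theorem val_sub (f g : ZIrr G) (x : G) : (f - g).1 x = f.1 x - g.1 x := rfl

theorem val_one (x : G) : (1 : ZIrr G).1 x = 1 := rfl

theorem val_pow (f : ZIrr G) (n : ℕ) (x : G) : (f ^ n).1 x = f.1 x ^ n := rfl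

theorem val_intCast (n : ℤ) (x : G) : (n : ZIrr G).1 x = n := rfl

theorem val_sum {ι : Type*} (t : Finset ι) (f : ι → ZIrr G) (x : G) :
    (∑ i ∈ t, f i).1 x = ∑ i ∈ t, (f i).1 x := by
  rw [AddSubmonoidClass.coe_finsetSum, Finset.sum_apply]

variable {s : ZMod 8}

instance : Fintype (C8C4 s) :=
  Fintype.ofEquiv (Multiplicative A × Multiplicative (ZMod 4)) SemidirectProduct.equivProd.symm

theorem card_C8C4 : Nat.card (C8C4 s) = 256 := by
  rw [SemidirectProduct.card]
  simp

theorem sum_C8C4 (F : C8C4 s → ℂ) : ∑ g, F g = ∑ l : ZMod 4, ∑ v : A, F (el v l) := by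
  rw [← SemidirectProduct.equivProd.symm.sum_comp, Fintype.sum_prod_type_right]
  rfl

theorem sum_zmod_eight_of_periodic (F : ZMod 8 → ℂ) (h : ∀ x w, F (x + 2 * w) = F x) :
    ∑ x, F x = 4 * (F 0 + F 1) := by
  have h2 : F 2 = F 0 := h 0 1
  have h4 : F 4 = F 0 := h 0 2
  have h6 : F 6 = F 0 := h 0 3
  have h3 : F 3 = F 1 := h 1 1
  have h5 : F 5 = F 1 := h 1 2
  have h7 : F 7 = F 1 := h 1 3
  refine (Fin.sum_univ_eight F).trans ?_
  linear_combination h2 + h3 + h4 + h5 + h6 + h7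

theorem sum_of_periodic (F : A → ℂ) (h : ∀ v w, F (v + 2 * w) = F v) :
    ∑ v, F v = 16 * (F (0, 0) + F (1, 0) + F (0, 1) + F (1, 1)) := by
  have h1 : ∀ x, ∑ y, F (x, y) = 4 * (F (x, 0) + F (x, 1)) := fun x =>
    sum_zmod_eight_of_periodic (fun y => F (x, y)) fun y w => by
      have h0 := h (x, y) (0, w)
      simpa only [Prod.mk_add_mk, Prod.mk_mul_mk, mul_zero, add_zero,
        show (2 : A) = ((2 : ZMod 8), (2 : ZMod 8)) from rfl] using h0
  rw [Fintype.sum_prod_type, sum_zmod_eight_of_periodic]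
  · rw [h1, h1]
    ring
  · intro x w
    rw [h1, h1]
    have h0 := h (x, 0) (w, 0)
    have h1 := h (x, 1) (w, 0)
    simp only [Prod.mk_add_mk, Prod.mk_mul_mk, mul_zero, add_zero,
      show (2 : A) = ((2 : ZMod 8), (2 : ZMod 8)) from rfl] at h0 h1
    rw [h0, h1]

/-- The generalized characters that are constant on the cosets of `2 (C₈ × C₈)`. -/
def IsPeriodic (f : ZIrr (C8C4 s)) : Prop := ∀ v w l, f.1 (el (v + 2 * w) l) = f.1 (el v l)

/-- A representative of the nontrivial `t`-invariant coset of `2 (C₈ × C₈)`. -/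
def fixVec (s : ZMod 8) : A := (s + 1, 1)

/-- The four cosets of 2A are represented in a way adapted to `t`, which fixes the first two and
interchanges the others. -/
theorem sum_of_periodic' (hs : s = 1 ∨ s = 2) (F : A → ℂ) (h : ∀ v w, F (v + 2 * w) = F v) :
    ∑ v, F v = 16 * (F 0 + F (fixVec s) + F (1, 0) + F (tAdd s (1, 0))) := by
  rw [sum_of_periodic F h]
  rcases hs with rfl | rfl
  · have h1 : F (fixVec 1) = F (0, 1) := h (0, 1) (1, 0)
    have h2 : F (tAdd 1 (1, 0)) = F (1, 1) := h (1, 1) (0, 3)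
    rw [h1, h2]
    change 16 * (F 0 + _ + _ + _) = _
    ring
  · have h1 : F (fixVec 2) = F (1, 1) := h (1, 1) (1, 0)
    have h2 : F (tAdd 2 (1, 0)) = F (0, 1) := h (0, 1) (1, 3)
    rw [h1, h2]
    change 16 * (F 0 + _ + _ + _) = _
    ring

theorem exists_rep (hs : s = 1 ∨ s = 2) (v : A) : ∃ w, v = 0 + 2 * w ∨ v = fixVec s + 2 * w ∨
    v = (1, 0) + 2 * w ∨ v = tAdd s (1, 0) + 2 * w := by
  rcases hs with rfl | rfl <;> revert v <;> decide +kernel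

/-- Odd powers of `t` act on A/2A by interchanging `(1, 0)` with its sum with `fixVec s`. Hence 0
and `fixVec s` give conjugate elements modulo 2A in the odd cosets, which is what
`IsPeriodic.apply_fixVec` uses. -/
theorem exists_fixVec_eq (hs : s = 1 ∨ s = 2) (l : ZMod 4) (hl : l = 1 ∨ l = 3) :
    ∃ w, fixVec s = 0 + (1, 0) - tPow s l (1, 0) + 2 * w := by
  rcases hs with rfl | rfl <;> rcases hl with rfl | rfl <;> decide +kernel

theorem IsPeriodic.apply_fixVec (hs : s = 1 ∨ s = 2) {f : ZIrr (C8C4 s)} (hf : IsPeriodic f)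
    {l : ZMod 4} (hl : l = 1 ∨ l = 3) : f.1 (el (fixVec s) l) = f.1 (el 0 l) := by
  obtain ⟨w, hw⟩ := exists_fixVec_eq hs l hl
  rw [hw, hf, apply_add_sub]

theorem IsPeriodic.ext (hs : s = 1 ∨ s = 2) {f g : ZIrr (C8C4 s)} (hf : IsPeriodic f)
    (hg : IsPeriodic g) (h0 : ∀ l, f.1 (el 0 l) = g.1 (el 0 l))
    (h1 : ∀ l, f.1 (el (fixVec s) l) = g.1 (el (fixVec s) l))
    (h2 : ∀ l, f.1 (el (1, 0) l) = g.1 (el (1, 0) l)) : f = g := by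
  ext x
  obtain ⟨v, l, rfl⟩ := eq_el x
  obtain ⟨w, rfl | rfl | rfl | rfl⟩ := exists_rep hs v
  · rw [hf, hg, h0]
  · rw [hf, hg, h1]
  · rw [hf, hg, h2]
  · rw [hf, hg, apply_tAdd, apply_tAdd, h2]

theorem IsPeriodic.avg_mul (hs : s = 1 ∨ s = 2) {f g : ZIrr (C8C4 s)} (hf : IsPeriodic f)
    (hg : IsPeriodic g) : 16 * (avg (f * g) : ℂ) = ∑ l : ZMod 4,
      (f.1 (el 0 l) * g.1 (el 0 l) + f.1 (el (fixVec s) l) * g.1 (el (fixVec s) l) +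
        2 * (f.1 (el (1, 0) l) * g.1 (el (1, 0) l))) := by
  have h := avg_spec (f * g)
  rw [sum_C8C4, card_C8C4] at h
  have h1 : ∀ l : ZMod 4, ∑ v : A, (f * g).1 (el v l) =
      16 * (f.1 (el 0 l) * g.1 (el 0 l) + f.1 (el (fixVec s) l) * g.1 (el (fixVec s) l) +
        2 * (f.1 (el (1, 0) l) * g.1 (el (1, 0) l))) := by
    intro l
    rw [sum_of_periodic' hs _ (fun v w => by rw [val_mul, val_mul, hf, hg])]
    simp only [val_mul, apply_tAdd]
    ring
  rw [Finset.sum_congr rfl fun l _ => h1 l, ← Finset.mul_sum] at h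
  push_cast at h
  linear_combination -h / 16

theorem pairing_two_mul {p : A} (hp : 2 * p = 0) (v w : A) :
    pairing p (v + 2 * w) = pairing p v := by
  have h1 : 2 * p.1 = 0 := congrArg Prod.fst hp
  have h2 : 2 * p.2 = 0 := congrArg Prod.snd hp
  rw [pairing_add_right, add_eq_left]
  change p.1 * (2 * w.1) + p.2 * (2 * w.2) = 0
  linear_combination w.1 * h1 + w.2 * h2

theorem isPeriodic_intCast (n : ℤ) : IsPeriodic (n : ZIrr (C8C4 s)) := fun _ _ _ => rfl

theorem isPeriodic_tau : IsPeriodic (tau s) := fun _ _ _ => rfl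

theorem isPeriodic_mu : IsPeriodic (mu s) := fun v w l => by
  rw [mu_apply, mu_apply, pairing_two_mul]
  revert s
  decide

theorem isPeriodic_psi : IsPeriodic (psi s) := fun v w l => by
  have h : ∀ i, 2 * psiDual s i = 0 := by
    revert s
    decide
  rw [psi_apply, psi_apply, pairing_two_mul (h 0), pairing_two_mul (h 1)]

theorem IsPeriodic.mul {f g : ZIrr (C8C4 s)} (hf : IsPeriodic f) (hg : IsPeriodic g) :
    IsPeriodic (f * g) := fun v w l => by rw [val_mul, val_mul, hf, hg]

theorem IsPeriodic.add {f g : ZIrr (C8C4 s)} (hf : IsPeriodic f) (hg : IsPeriodic g) :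
    IsPeriodic (f + g) := fun v w l => by rw [val_add, val_add, hf, hg]

theorem IsPeriodic.pow {f : ZIrr (C8C4 s)} (hf : IsPeriodic f) (n : ℕ) :
    IsPeriodic (f ^ n) := fun v w l => by rw [val_pow, val_pow, hf]

theorem mu_zero (l : ZMod 4) : (mu s).1 (el 0 l) = 1 := by
  rw [mu_apply]
  simp [pairing]

theorem mu_fixVec (l : ZMod 4) : (mu s).1 (el (fixVec s) l) = 1 := by
  rw [mu_apply, show pairing (muDual s) (fixVec s) = 0 by revert s; decide]
  simp

theorem mu_one_zero (l : ZMod 4) : (mu s).1 (el (1, 0) l) = -1 := by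
  rw [mu_apply, show pairing (muDual s) (1, 0) = 4 by revert s; decide, stdAddChar_four]

theorem psi_zero (l : ZMod 4) : (psi s).1 (el 0 l) = if l = 0 ∨ l = 2 then 2 else 0 := by
  rw [psi_apply]
  simp [pairing]
  norm_num

theorem psi_fixVec (l : ZMod 4) :
    (psi s).1 (el (fixVec s) l) = if l = 0 ∨ l = 2 then -2 else 0 := by
  rw [psi_apply, show pairing (psiDual s 0) (fixVec s) = 4 by revert s; decide,
    show pairing (psiDual s 1) (fixVec s) = 4 by revert s; decide, stdAddChar_four]
  norm_num

theorem psi_one_zero (l : ZMod 4) : (psi s).1 (el (1, 0) l) = 0 := by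
  rw [psi_apply, show pairing (psiDual s 0) (1, 0) = 0 by revert s; decide,
    show pairing (psiDual s 1) (1, 0) = 4 by revert s; decide, stdAddChar_four]
  simp

theorem tau_zero (v : A) : (tau s).1 (el v 0) = 1 := pow_zero _

theorem tau_one (v : A) : (tau s).1 (el v 1) = Complex.I := pow_one _

theorem tau_two (v : A) : (tau s).1 (el v 2) = -1 := Complex.I_sq

theorem tau_three (v : A) : (tau s).1 (el v 3) = -Complex.I := Complex.I_pow_three

theorem forall_zmod_four {p : ZMod 4 → Prop} (h0 : p 0) (h1 : p 1) (h2 : p 2) (h3 : p 3) (l) :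
    p l := by
  have : l = 0 ∨ l = 1 ∨ l = 2 ∨ l = 3 := by revert l; decide
  rcases this with rfl | rfl | rfl | rfl <;> assumption

theorem sum_zmod_four {M : Type*} [AddCommMonoid M] (F : ZMod 4 → M) :
    ∑ l, F l = F 0 + F 1 + F 2 + F 3 :=
  Fin.sum_univ_four F

/-- A periodic generalized character is an integral combination of the characters `τᵏ`, `τᵏμ` and
`τᵏψ`. -/
theorem IsPeriodic.exists_eq (hs : s = 1 ∨ s = 2) {f : ZIrr (C8C4 s)} (hf : IsPeriodic f) :
    ∃ (n m : ZMod 4 → ℤ) (a b : ℤ),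
      f = (n 0 + n 1 * tau s + n 2 * tau s ^ 2 + n 3 * tau s ^ 3) +
        (m 0 + m 1 * tau s + m 2 * tau s ^ 2 + m 3 * tau s ^ 3) * mu s +
        (a + b * tau s) * psi s ∧
      (f.1 (el (fixVec s) 0) = f.1 (el (1, 0) 0) → f.1 (el (fixVec s) 2) = f.1 (el (1, 0) 2) →
        a = m 0 + m 2 ∧ b = m 1 + m 3) := by
  have hτ : ∀ k, IsPeriodic (tau s ^ k) := isPeriodic_tau.pow
  have hN : ∀ k, _ := fun k => hf.avg_mul hs (hτ k)
  have hM : ∀ k, _ := fun k => hf.avg_mul hs ((hτ k).mul isPeriodic_mu)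
  have ha := hf.avg_mul hs isPeriodic_psi
  have hb := hf.avg_mul hs (isPeriodic_tau.mul isPeriodic_psi)
  have hN0 := hN 0
  -- The multiplicity of τᵏ or τᵏμ is the average against the complex conjugate, so the exponents 1
  -- and 3 are interchanged. The characters ψ and τψ are real.
  have hN1 := hN 3
  have hN2 := hN 2
  have hN3 := hN 1
  have hM0 := hM 0
  have hM1 := hM 3
  have hM2 := hM 2
  have hM3 := hM 1
  clear hN hM
  have e1 : (1 : ZMod 4) ≠ 0 ∧ (1 : ZMod 4) ≠ 2 ∧ (3 : ZMod 4) ≠ 0 ∧ (3 : ZMod 4) ≠ 2 := by decide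
  have hI : Complex.I ^ 2 = -1 := Complex.I_sq
  have hI3 : Complex.I ^ 3 = -Complex.I := Complex.I_pow_three
  have hI2' : (-Complex.I) ^ 2 = -1 := by rw [neg_sq, hI]
  have hI3' : (-Complex.I) ^ 3 = Complex.I := by rw [Odd.neg_pow (by decide), hI3, neg_neg]
  simp only [sum_zmod_four, val_mul, val_pow, mu_zero, mu_fixVec, mu_one_zero, psi_zero,
    psi_fixVec, psi_one_zero, tau_zero, tau_one, tau_two, tau_three,
    hf.apply_fixVec hs (Or.inl rfl), hf.apply_fixVec hs (Or.inr rfl), e1.1, e1.2.1, e1.2.2.1,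
    e1.2.2.2, or_self, or_true, true_or, if_true, if_false, hI, hI3, hI2', hI3'] at ha hb hN0 hN1 hN2 hN3 hM0 hM1 hM2 hM3
  refine ⟨![avg (f * tau s ^ 0), avg (f * tau s ^ 3), avg (f * tau s ^ 2), avg (f * tau s ^ 1)],
    ![avg (f * (tau s ^ 0 * mu s)), avg (f * (tau s ^ 3 * mu s)), avg (f * (tau s ^ 2 * mu s)),
      avg (f * (tau s ^ 1 * mu s))], avg (f * psi s), avg (f * (tau s * psi s)), ?_, ?_⟩
  · generalize avg (f * tau s ^ 0) = n0 at *
    generalize avg (f * tau s ^ 1) = n3 at *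
    generalize avg (f * tau s ^ 2) = n2 at *
    generalize avg (f * tau s ^ 3) = n1 at *
    generalize avg (f * (tau s ^ 0 * mu s)) = m0 at *
    generalize avg (f * (tau s ^ 1 * mu s)) = m3 at *
    generalize avg (f * (tau s ^ 2 * mu s)) = m2 at *
    generalize avg (f * (tau s ^ 3 * mu s)) = m1 at *
    generalize avg (f * psi s) = a at *
    generalize avg (f * (tau s * psi s)) = b at *
    change f = (n0 + n1 * tau s + n2 * tau s ^ 2 + n3 * tau s ^ 3) +
        (m0 + m1 * tau s + m2 * tau s ^ 2 + m3 * tau s ^ 3) * mu s +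
        (a + b * tau s) * psi s
    have hcub : ∀ a b c d : ℤ, IsPeriodic
        (a + b * tau s + c * tau s ^ 2 + d * tau s ^ 3 : ZIrr (C8C4 s)) := fun a b c d =>
      (((isPeriodic_intCast a).add ((isPeriodic_intCast b).mul isPeriodic_tau)).add
        ((isPeriodic_intCast c).mul (hτ 2))).add ((isPeriodic_intCast d).mul (hτ 3))
    refine hf.ext hs (((hcub n0 n1 n2 n3).add ((hcub m0 m1 m2 m3).mul isPeriodic_mu)).add
      (((isPeriodic_intCast a).add ((isPeriodic_intCast b).mul isPeriodic_tau)).mul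
        isPeriodic_psi)) ?_ ?_ ?_ <;> refine forall_zmod_four ?_ ?_ ?_ ?_ <;>
    simp only [val_add, val_mul, val_pow, val_intCast, mu_zero, mu_fixVec, mu_one_zero, psi_zero,
      psi_fixVec, psi_one_zero, tau_zero, tau_one, tau_two, tau_three,
      hf.apply_fixVec hs (Or.inl rfl), hf.apply_fixVec hs (Or.inr rfl), e1.1, e1.2.1, e1.2.2.1,
      e1.2.2.2, or_self, or_true, true_or, if_true, if_false, hI, hI3, hI2', hI3']
    -- Each of the twelve cases is Fourier inversion: the multiplicities are recombined with the
    -- values of the corresponding characters at the given class.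
    · linear_combination -(hN0 + hN1 + hN2 + hN3 + (hM0 + hM1 + hM2 + hM3) + 2 *  (ha + hb)) / 16
    · linear_combination -(hN0 + Complex.I * hN1 - hN2 - Complex.I * hN3 + (hM0 + Complex.I * hM1 - hM2 - Complex.I * hM3)) / 16 +
        (f.1 (el 0 1) - f.1 (el 0 3)) / 2 * hI
    · linear_combination -(hN0 - hN1 + hN2 - hN3 + (hM0 - hM1 + hM2 - hM3) + 2 *  (ha - hb)) / 16
    · linear_combination -(hN0 - Complex.I * hN1 - hN2 + Complex.I * hN3 + (hM0 - Complex.I * hM1 - hM2 + Complex.I * hM3)) / 16 +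
        (f.1 (el 0 3) - f.1 (el 0 1)) / 2 * hI
    · linear_combination -(hN0 + hN1 + hN2 + hN3 + (hM0 + hM1 + hM2 + hM3) - 2 *  (ha + hb)) / 16
    · linear_combination -(hN0 + Complex.I * hN1 - hN2 - Complex.I * hN3 + (hM0 + Complex.I * hM1 - hM2 - Complex.I * hM3)) / 16 +
        (f.1 (el 0 1) - f.1 (el 0 3)) / 2 * hI
    · linear_combination -(hN0 - hN1 + hN2 - hN3 + (hM0 - hM1 + hM2 - hM3) - 2 *  (ha - hb)) / 16
    · linear_combination -(hN0 - Complex.I * hN1 - hN2 + Complex.I * hN3 + (hM0 - Complex.I * hM1 - hM2 + Complex.I * hM3)) / 16 +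
        (f.1 (el 0 3) - f.1 (el 0 1)) / 2 * hI
    · linear_combination -(hN0 + hN1 + hN2 + hN3 - (hM0 + hM1 + hM2 + hM3)) / 16
    · linear_combination -(hN0 + Complex.I * hN1 - hN2 - Complex.I * hN3 - (hM0 + Complex.I * hM1 - hM2 - Complex.I * hM3)) / 16 +
        (f.1 (el (1, 0) 1) - f.1 (el (1, 0) 3)) / 2 * hI
    · linear_combination -(hN0 - hN1 + hN2 - hN3 - (hM0 - hM1 + hM2 - hM3)) / 16
    · linear_combination -(hN0 - Complex.I * hN1 - hN2 + Complex.I * hN3 - (hM0 - Complex.I * hM1 - hM2 + Complex.I * hM3)) / 16 +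
        (f.1 (el (1, 0) 3) - f.1 (el (1, 0) 1)) / 2 * hI
  -- Equal values at `fixVec s` and `(1, 0)` on A and At² mean that the three nontrivial characters
  -- of A/2A occur equally often there. The multiplicities of ψ and τψ are then those of the
  -- extensions of μ with the same restriction to At².
  · intro h0 h2
    constructor
    · have : (avg (f * psi s) : ℂ) =
        (avg (f * (tau s ^ 0 * mu s)) + avg (f * (tau s ^ 2 * mu s)) : ℤ) := by
        push_cast
        linear_combination (ha - hM0 - hM2) / 16 - (h0 + h2) / 4
      exact_mod_cast this
    · have : (avg (f * (tau s * psi s)) : ℂ) =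
        (avg (f * (tau s ^ 3 * mu s)) + avg (f * (tau s ^ 1 * mu s)) : ℤ) := by
        push_cast
        linear_combination (hb - hM1 - hM3) / 16 - (h0 - h2) / 4
      exact_mod_cast this

end Periodic

/-! ### Nilpotent ideals -/

section Nilpotent

theorem span_pair_pow_le {R : Type*} [CommRing R] (g h : R) (n : ℕ) :
    Ideal.span {g, h} ^ n ≤ Ideal.span {x | ∃ i ≤ n, x = g ^ i * h ^ (n - i)} := by
  induction n with
  | zero =>
    rw [pow_zero, Ideal.one_eq_top, top_le_iff, Ideal.eq_top_iff_one]
    exact Ideal.subset_span ⟨0, le_rfl, by simp⟩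
  | succ n ih =>
    rw [pow_succ]
    refine (Ideal.mul_mono_left ih).trans ?_
    rw [Ideal.span_mul_span', Ideal.span_le]
    rintro _ ⟨_, ⟨i, hi, rfl⟩, y, hy, rfl⟩
    rcases hy with rfl | rfl
    · exact Ideal.subset_span ⟨i + 1, by lia, by
        rw [show n + 1 - (i + 1) = n - i by lia]
        ring⟩
    · exact Ideal.subset_span ⟨i, by lia, by
        rw [show n + 1 - i = n - i + 1 by lia]
        ring⟩

theorem span_pair_pow_eq_bot {R : Type*} [CommRing R] {g h : R} {n : ℕ}
    (H : ∀ i ≤ n, g ^ i * h ^ (n - i) = 0) : Ideal.span {g, h} ^ n = ⊥ := by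
  refine eq_bot_iff.2 ((span_pair_pow_le g h n).trans ?_)
  rw [Ideal.span_le]
  rintro _ ⟨i, hi, rfl⟩
  exact H i hi

variable {R E : Type*} [CommRing R] [CommRing E] (r : R →+* E) (T : E →+ R)
  (hT : ∀ a b, T (a * r b) = T a * b)

/-- The image of an ideal under a map that satisfies the projection formula. -/
def transferIdeal (I : Ideal E) : Ideal R where
  carrier := T '' I
  add_mem' := by
    rintro _ _ ⟨a, ha, rfl⟩ ⟨b, hb, rfl⟩
    exact ⟨a + b, add_mem ha hb, map_add T a b⟩
  zero_mem' := ⟨0, zero_mem I, map_zero T⟩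
  smul_mem' := by
    rintro c _ ⟨a, ha, rfl⟩
    exact ⟨a * r c, I.mul_mem_right _ ha, by rw [hT, smul_eq_mul, mul_comm]⟩

theorem transferIdeal_mul_le {I : Ideal E} {K : Ideal R} {L : Ideal E} (h : K.map r ≤ L) :
    transferIdeal r T hT I * K ≤ transferIdeal r T hT (I * L) := by
  rw [Ideal.mul_le]
  rintro _ ⟨a, ha, rfl⟩ b hb
  exact ⟨a * r b, Ideal.mul_mem_mul ha (h (Ideal.mem_map_of_mem r hb)), hT a b⟩

/-- An ideal of `R` is nilpotent modulo `2` if it is the sum of such an ideal and of an ideal of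
transfers, and if its image in `E` is nilpotent modulo `2`. -/
theorem pow_le_span_two {I K : Ideal R} (hI : I ≤ K ⊔ transferIdeal r T hT ⊤ ⊔ Ideal.span {2})
    (hK : K ≤ I) {n : ℕ} (hKn : K ^ (n + 1) ≤ Ideal.span {2})
    (hn : I.map r ^ n ≤ Ideal.span {2}) : I ^ (n + 1) ≤ Ideal.span {2} := by
  -- A product of `k + 1` elements either has all factors in `K`, or has one transfer factor, which
  -- absorbs the other `k` factors by the projection formula; all this modulo 2.
  have key : ∀ k, I ^ (k + 1) ≤
      K ^ (k + 1) ⊔ transferIdeal r T hT (I.map r ^ k) ⊔ Ideal.span {2} := by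
    intro k
    induction k with
    | zero => simpa [Ideal.one_eq_top] using hI
    | succ k ih =>
      rw [pow_succ]
      have h1 : transferIdeal r T hT ⊤ * K ^ (k + 1) ≤
          transferIdeal r T hT (I.map r ^ (k + 1)) := by
        have hle : (K ^ (k + 1)).map r ≤ I.map r ^ (k + 1) := by
          rw [Ideal.map_pow]
          exact Ideal.pow_right_mono (Ideal.map_mono hK) _
        have := transferIdeal_mul_le r T hT (I := ⊤) hle
        rwa [Ideal.top_mul] at this
      have h2 : transferIdeal r T hT (I.map r ^ k) * I ≤
          transferIdeal r T hT (I.map r ^ (k + 1)) := by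
        rw [pow_succ (I.map r)]
        exact transferIdeal_mul_le r T hT le_rfl
      have h3 : K ^ (k + 1) * I ≤ K ^ (k + 1 + 1) ⊔
          transferIdeal r T hT (I.map r ^ (k + 1)) ⊔ Ideal.span {2} := by
        refine (Ideal.mul_mono_right hI).trans ?_
        rw [Ideal.mul_sup, Ideal.mul_sup, ← pow_succ, mul_comm _ (transferIdeal r T hT ⊤)]
        exact sup_le_sup (sup_le_sup le_rfl h1) Ideal.mul_le_right
      refine (Ideal.mul_mono_left ih).trans ?_
      rw [Ideal.sup_mul, Ideal.sup_mul]
      exact sup_le (sup_le h3 (h2.trans (le_sup_right.trans le_sup_left)))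
        (Ideal.mul_le_left.trans le_sup_right)
  refine (key n).trans (sup_le (sup_le hKn ?_) le_rfl)
  -- The additive map `T` sends multiples of 2 to multiples of 2.
  rintro _ ⟨a, ha, rfl⟩
  obtain ⟨b, rfl⟩ := Ideal.mem_span_singleton.1 (hn ha)
  rw [two_mul, map_add, ← two_mul]
  exact Ideal.mul_mem_right _ _ (Ideal.mem_span_singleton_self 2)

end Nilpotent

/-! ### Computation in the group algebra of `C₈ × C₈` over the field with two elements

The subsets of `C₈ × C₈` are encoded by natural numbers: the bit `8 a + b` stands for the element
`X ^ a * Y ^ b`. -/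

section Bits

/-- The sum modulo `2` of the values of `F` at the bits of `n`. -/
def xorOver (n : ℕ) (F : ℕ → ℕ) : ℕ :=
  (List.range 64).foldr (fun i acc => cond (n.testBit i) (F i ^^^ acc) acc) 0

/-- The position of the product of the monomials at positions `i` and `j`. -/
def bitAdd (i j : ℕ) : ℕ := (i / 8 + j / 8) % 8 * 8 + (i % 8 + j % 8) % 8

/-- Multiplication in the group algebra. -/
def bitMul (n m : ℕ) : ℕ := xorOver n fun i => xorOver m fun j => 2 ^ bitAdd i j

variable {R : Type*} [CommRing R] (X Y : R)

/-- The monomial at the position `i`. -/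
def bitMono (i : ℕ) : R := X ^ (i / 8) * Y ^ (i % 8)

/-- The element of a ring that is encoded by `n`. -/
def bitEval (n : ℕ) : R :=
  ((List.range 64).map fun i => cond (n.testBit i) (bitMono X Y i) 0).sum

theorem bitEval_zero : bitEval X Y 0 = 0 := by
  unfold bitEval
  simp

theorem bitEval_two_pow {i : ℕ} (hi : i < 64) : bitEval X Y (2 ^ i) = bitMono X Y i := by
  unfold bitEval
  rw [List.sum_map_eq_nsmul_single i, List.count_eq_one_of_mem List.nodup_range]
  · simp
  · simpa using hi
  · intro j hj _
    rw [Nat.testBit_two_pow_of_ne hj.symm]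
    rfl

variable {X Y}

/-- In characteristic 2 the common monomials cancel, so addition is symmetric difference. -/
theorem bitEval_xor (h2 : (2 : R) = 0) (n m : ℕ) :
    bitEval X Y (n ^^^ m) = bitEval X Y n + bitEval X Y m := by
  unfold bitEval
  rw [← List.sum_map_add]
  congr 2
  funext i
  rw [Nat.testBit_xor]
  cases n.testBit i <;> cases m.testBit i <;> simp
  rw [← two_mul, h2, zero_mul]

theorem bitEval_xorOver (h2 : (2 : R) = 0) (n : ℕ) (F : ℕ → ℕ) :
    bitEval X Y (xorOver n F) =
      ((List.range 64).map fun i => cond (n.testBit i) (bitEval X Y (F i)) 0).sum := by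
  unfold xorOver
  induction List.range 64 with
  | nil => exact bitEval_zero X Y
  | cons i l ih =>
    rw [List.foldr_cons, List.map_cons, List.sum_cons, ← ih]
    cases n.testBit i
    · simp
    · exact bitEval_xor h2 _ _

theorem bitMono_bitAdd (hX : X ^ 8 = 1) (hY : Y ^ 8 = 1) (i j : ℕ) :
    bitMono X Y (bitAdd i j) = bitMono X Y i * bitMono X Y j := by
  have h1 : bitAdd i j / 8 = (i / 8 + j / 8) % 8 := by
    unfold bitAdd
    lia
  have h2 : bitAdd i j % 8 = (i % 8 + j % 8) % 8 := by
    unfold bitAdd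
    lia
  unfold bitMono
  rw [h1, h2, ← pow_eq_pow_mod _ hX, ← pow_eq_pow_mod _ hY]
  ring

theorem bitEval_bitMul (h2 : (2 : R) = 0) (hX : X ^ 8 = 1) (hY : Y ^ 8 = 1) (n m : ℕ) :
    bitEval X Y (bitMul n m) = bitEval X Y n * bitEval X Y m := by
  unfold bitMul
  have hi : ∀ i, bitEval X Y (xorOver m fun j => 2 ^ bitAdd i j) =
      bitMono X Y i * bitEval X Y m := by
    intro i
    rw [bitEval_xorOver h2]
    conv_rhs => rw [bitEval]
    rw [← List.sum_map_mul_left]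
    congr 2
    funext j
    have : bitAdd i j < 64 := by
      unfold bitAdd
      lia
    rw [bitEval_two_pow X Y this, bitMono_bitAdd hX hY]
    cases m.testBit j <;> simp
  rw [bitEval_xorOver h2]
  simp_rw [hi]
  conv_rhs => rw [bitEval, ← List.sum_map_mul_right]
  congr 2
  funext i
  cases n.testBit i <;> simp

/-- The position of an element of `C₈ × C₈`. -/
def bitPos (p : A) : ℕ := p.1.val * 8 + p.2.val

/-- The monomial with parameter `p`. -/
def monoA (X Y : R) (p : A) : R := X ^ p.1.val * Y ^ p.2.val

theorem bitEval_two_pow_bitPos (p : A) : bitEval X Y (2 ^ bitPos p) = monoA X Y p := by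
  have h1 := ZMod.val_lt p.1
  have h2 := ZMod.val_lt p.2
  rw [bitEval_two_pow X Y (by unfold bitPos; lia)]
  unfold bitMono monoA bitPos
  rw [show (p.1.val * 8 + p.2.val) / 8 = p.1.val by lia,
    show (p.1.val * 8 + p.2.val) % 8 = p.2.val by lia]

/-- The sum of the orbit of `p` under `t`. -/
def orbitBits (s : ZMod 8) (p : A) : ℕ :=
  2 ^ bitPos p ^^^ 2 ^ bitPos (tDual s p) ^^^ 2 ^ bitPos (tDual s (tDual s p)) ^^^
    2 ^ bitPos (tDual s (tDual s (tDual s p)))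

theorem bitEval_orbitBits (h2 : (2 : R) = 0) (s : ZMod 8) (p : A) :
    bitEval X Y (orbitBits s p) = ∑ l : ZMod 4, monoA X Y ((tDual s)^[l.val] p) := by
  unfold orbitBits
  simp only [bitEval_xor h2, bitEval_two_pow_bitPos, sum_zmod_four]
  rfl

/-- The dual of the automorphism `zAdd`. -/
def zDual (p : A) : A := (p.2, -p.1 - p.2)

/-- The sum of the orbit of `p` under `z` and `t`. -/
def bigOrbitBits (s : ZMod 8) (p : A) : ℕ :=
  orbitBits s p ^^^ orbitBits s (zDual p) ^^^ orbitBits s (zDual (zDual p))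

theorem bitEval_bigOrbitBits (h2 : (2 : R) = 0) (s : ZMod 8) (p : A) :
    bitEval X Y (bigOrbitBits s p) = ∑ i : Fin 3, ∑ l : ZMod 4,
      monoA X Y ((tDual s)^[l.val] (zDual^[i.val] p)) := by
  unfold bigOrbitBits
  simp only [bitEval_xor h2, bitEval_orbitBits h2, Fin.sum_univ_three]
  rfl

/-- The restriction of `μ - 1`. -/
def muBits (s : ZMod 8) : ℕ := 1 ^^^ 2 ^ bitPos (muDual s)

/-- The restriction of `ψ`. -/
def psiBits (s : ZMod 8) : ℕ := 2 ^ bitPos (psiDual s 0) ^^^ 2 ^ bitPos (psiDual s 1)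

theorem bitEval_muBits (h2 : (2 : R) = 0) (s : ZMod 8) :
    bitEval X Y (muBits s) = monoA X Y (muDual s) - 1 := by
  unfold muBits
  rw [bitEval_xor h2, bitEval_two_pow_bitPos, show 1 = 2 ^ bitPos 0 from rfl,
    bitEval_two_pow_bitPos, show monoA X Y 0 = 1 by simp [monoA]]
  linear_combination h2

theorem bitEval_psiBits (h2 : (2 : R) = 0) (s : ZMod 8) :
    bitEval X Y (psiBits s) = monoA X Y (psiDual s 0) + monoA X Y (psiDual s 1) := by
  unfold psiBits
  rw [bitEval_xor h2, bitEval_two_pow_bitPos, bitEval_two_pow_bitPos]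

/-- A list of elements of the ideal generated by `g` and `h`. -/
def combinations (g h : ℕ) (c : List (ℕ × ℕ)) : List ℕ :=
  c.map fun x => bitMul g x.1 ^^^ bitMul h x.2

theorem bitEval_mem_span (h2 : (2 : R) = 0) (hX : X ^ 8 = 1) (hY : Y ^ 8 = 1) {g h n : ℕ}
    {c : List (ℕ × ℕ)} (hn : n ∈ combinations g h c) :
    bitEval X Y n ∈ Ideal.span {bitEval X Y g, bitEval X Y h} := by
  obtain ⟨x, -, rfl⟩ := List.mem_map.1 hn
  rw [bitEval_xor h2, bitEval_bitMul h2 hX hY, bitEval_bitMul h2 hX hY]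
  exact Ideal.mem_span_pair.2 ⟨_, _, by rw [mul_comm, mul_comm (bitEval X Y x.2)]⟩

/-- The power `n` of an element of the group algebra. -/
def bitPow (g : ℕ) : ℕ → ℕ
  | 0 => 1
  | n + 1 => bitMul (bitPow g n) g

theorem bitEval_bitPow (h2 : (2 : R) = 0) (hX : X ^ 8 = 1) (hY : Y ^ 8 = 1) (g n : ℕ) :
    bitEval X Y (bitPow g n) = bitEval X Y g ^ n := by
  induction n with
  | zero =>
    rw [pow_zero]
    change bitEval X Y (2 ^ 0) = 1
    rw [bitEval_two_pow X Y (by norm_num)]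
    simp [bitMono]
  | succ n ih =>
    rw [pow_succ, ← ih]
    exact bitEval_bitMul h2 hX hY _ _

theorem bitEval_span_pow_eq_bot (h2 : (2 : R) = 0) (hX : X ^ 8 = 1) (hY : Y ^ 8 = 1) {g h n : ℕ}
    (H : ∀ i ≤ n, bitMul (bitPow g i) (bitPow h (n - i)) = 0) :
    Ideal.span {bitEval X Y g, bitEval X Y h} ^ n = ⊥ := by
  refine span_pair_pow_eq_bot fun i hi => ?_
  rw [← bitEval_bitPow h2 hX hY, ← bitEval_bitPow h2 hX hY, ← bitEval_bitMul h2 hX hY, H i hi,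
    bitEval_zero]

/-! ### Certificates in the group algebra -/

/-- Coefficients that express the orbit sums and the restrictions of `μ - 1` and `ψ` by two orbit
sums. -/
def orbitCoeffOne : List (ℕ × ℕ) :=
  [(0, 0), (2371535110304, 1285), (35745438367754, 1285), (0, 1), (22352353099844, 0),
    (4294967296, 0), (45097164800, 0), (22352420225092, 10), (730714900480, 0),
    (22352369877316, 10), (149577246835370, 0), (75111801819157, 10), (150221357711520, 1),
    (22283633623124, 0), (44704211140616, 1), (18778960430161, 10), (176620330156034, 1), (1, 0)]

/-- The right-hand side contains the codes of all `t`-orbit sums and of the restrictions of μ - 1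
and ψ, so that `orbitBits_mem` becomes a lookup. The entry 0 accounts for the points with 2p = 0,
whose orbits are short and cancel modulo 2. -/
theorem combinations_orbitCoeffOne :
    combinations (orbitBits 1 (0, 1)) (orbitBits 1 (1, 0)) orbitCoeffOne =
      [0, 4294967297, 68719476752, 83902720, 134218400, 45097164800, 1126191968813056,
        2251799847372800, 4785074605195264, 9007199800033280, 18014398509744196,
        144686934122823680, 360359438445445120, 576463638521446400, 1152939097866634240,
        2342012543723110400, 4611690416742338560, 9223407221226864650] := by
  decide +kernel

/-- Vanishing of all monomials of degree 5 in two generators kills the fifth power of the ideal they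
generate. -/
theorem orbitBits_powOne : ∀ i ≤ 5, bitMul (bitPow (orbitBits 1 (0, 1)) i)
    (bitPow (orbitBits 1 (1, 0)) (5 - i)) = 0 := by
  decide +kernel

/-- Coefficients that express the orbit sums and the restrictions of `μ - 1` and `ψ` by two orbit
sums. -/
def orbitCoeffTwo : List (ℕ × ℕ) :=
  [(0, 0), (75645064, 2565), (1076364424, 2565), (6983819264, 0), (68719476736, 0),
    (172095050114, 1), (70540609978368, 0), (141101084224017, 10), (4957762359552, 0),
    (19422127325184, 0), (35547867294225, 10), (2481020305941, 10), (551098663306, 1),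
    (2688851984, 0), (9690960034, 1), (8820291348561, 10), (1, 0), (0, 1)]

theorem combinations_orbitCoeffTwo :
    combinations (orbitBits 2 (0, 1)) (orbitBits 2 (1, 1)) orbitCoeffTwo =
      [0, 68719476737, 4294967312, 4399120252968, 70540609978368, 175922028216320,
        281767034552320, 580542416289792, 4503599628419140, 19140298420781056, 36029896547500032,
        74309393853710592, 144117389246627840, 288230934497476608, 576469548933324800,
        1161928703862116352, 4611686018427389058, 11529215046068472320] := by
  decide +kernel

theorem orbitBits_powTwo : ∀ i ≤ 5, bitMul (bitPow (orbitBits 2 (0, 1)) i)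
    (bitPow (orbitBits 2 (1, 1)) (5 - i)) = 0 := by
  decide +kernel

/-- Coefficients that express the orbit sums and the restriction of `μ + ψ - 1` by two orbit
sums. -/
def bigOrbitCoeffOne : List (ℕ × ℕ) :=
  [(0, 0), (11109192319, 0), (11115090645, 0), (1, 0), (0, 1), (3301957440034, 1),
    (3299396152694, 0)]

/-- The analogous certificate for sums over ⟨z, t⟩. Only the combination μ - 1 + ψ is available
here, and degree 4 already suffices for nilpotency. -/
theorem combinations_bigOrbitCoeffOne :
    combinations (bigOrbitBits 1 (0, 5)) (bigOrbitBits 1 (1, 2)) bigOrbitCoeffOne =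
      [0, 73014444049, 23925665083752516, 144686934340944800, 4071415280111191040,
        4613942261686876160, 9592773859472343050] := by
  decide +kernel

theorem bigOrbitBits_powOne : ∀ i ≤ 4, bitMul (bitPow (bigOrbitBits 1 (0, 5)) i)
    (bitPow (bigOrbitBits 1 (1, 2)) (4 - i)) = 0 := by
  decide +kernel

/-- Coefficients that express the orbit sums and the restriction of `μ + ψ - 1` by two orbit
sums. -/
def bigOrbitCoeffTwo : List (ℕ × ℕ) :=
  [(0, 0), (10108449920, 0), (10102551594, 0), (1, 0), (0, 1), (3300257347721, 0),
    (3301118527453, 1)]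

theorem combinations_bigOrbitCoeffTwo :
    combinations (bigOrbitBits 2 (0, 3)) (bigOrbitBits 2 (1, 4)) bigOrbitCoeffTwo =
      [0, 73014444049, 23925665083752516, 612503844601077800, 1162175166500311040,
        4830112801527727490, 11818026522982238720] := by
  decide +kernel

theorem bigOrbitBits_powTwo : ∀ i ≤ 4, bitMul (bitPow (bigOrbitBits 2 (0, 3)) i)
    (bitPow (bigOrbitBits 2 (1, 4)) (4 - i)) = 0 := by
  decide +kernel

variable {s : ZMod 8}

theorem orbitBits_mem (hs : s = 1 ∨ s = 2) : ∃ g h c, (∀ p, orbitBits s p ∈ combinations g h c) ∧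
    muBits s ∈ combinations g h c ∧ psiBits s ∈ combinations g h c ∧
    ∀ i ≤ 5, bitMul (bitPow g i) (bitPow h (5 - i)) = 0 := by
  rcases hs with rfl | rfl
  · refine ⟨_, _, orbitCoeffOne, ?_, ?_, ?_, orbitBits_powOne⟩ <;>
      rw [combinations_orbitCoeffOne] <;> decide +kernel
  · refine ⟨_, _, orbitCoeffTwo, ?_, ?_, ?_, orbitBits_powTwo⟩ <;>
      rw [combinations_orbitCoeffTwo] <;> decide +kernel

theorem bigOrbitBits_mem (hs : s = 1 ∨ s = 2) : ∃ g h c,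
    (∀ p, bigOrbitBits s p ∈ combinations g h c) ∧ muBits s ^^^ psiBits s ∈ combinations g h c ∧
    ∀ i ≤ 4, bitMul (bitPow g i) (bitPow h (4 - i)) = 0 := by
  rcases hs with rfl | rfl
  · refine ⟨_, _, bigOrbitCoeffOne, ?_, ?_, bigOrbitBits_powOne⟩ <;>
      rw [combinations_bigOrbitCoeffOne] <;> decide +kernel
  · refine ⟨_, _, bigOrbitCoeffTwo, ?_, ?_, bigOrbitBits_powTwo⟩ <;>
      rw [combinations_bigOrbitCoeffTwo] <;> decide +kernel

theorem span_orbit_pow_eq_bot (hs : s = 1 ∨ s = 2) (h2 : (2 : R) = 0) (hX : X ^ 8 = 1)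
    (hY : Y ^ 8 = 1) : Ideal.span ({monoA X Y (muDual s) - 1,
      monoA X Y (psiDual s 0) + monoA X Y (psiDual s 1)} ∪
      Set.range fun p => ∑ l : ZMod 4, monoA X Y ((tDual s)^[l.val] p)) ^ 5 = ⊥ := by
  obtain ⟨g, h, c, h1, hm, hp, H⟩ := orbitBits_mem hs
  rw [eq_bot_iff, ← bitEval_span_pow_eq_bot h2 hX hY H]
  refine Ideal.pow_right_mono (Ideal.span_le.2 ?_) 5
  rintro _ ((rfl | rfl) | ⟨p, rfl⟩)
  · rw [← bitEval_muBits h2]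
    exact bitEval_mem_span h2 hX hY hm
  · rw [← bitEval_psiBits h2]
    exact bitEval_mem_span h2 hX hY hp
  · dsimp only
    rw [← bitEval_orbitBits h2]
    exact bitEval_mem_span h2 hX hY (h1 p)

theorem span_bigOrbit_pow_eq_bot (hs : s = 1 ∨ s = 2) (h2 : (2 : R) = 0) (hX : X ^ 8 = 1)
    (hY : Y ^ 8 = 1) : Ideal.span ({monoA X Y (muDual s) - 1 +
      (monoA X Y (psiDual s 0) + monoA X Y (psiDual s 1))} ∪
      Set.range fun p => ∑ i : Fin 3, ∑ l : ZMod 4,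
        monoA X Y ((tDual s)^[l.val] (zDual^[i.val] p))) ^ 4 = ⊥ := by
  obtain ⟨g, h, c, h1, hm, H⟩ := bigOrbitBits_mem hs
  rw [eq_bot_iff, ← bitEval_span_pow_eq_bot h2 hX hY H]
  refine Ideal.pow_right_mono (Ideal.span_le.2 ?_) 4
  rintro _ (rfl | ⟨p, rfl⟩)
  · rw [← bitEval_muBits h2, ← bitEval_psiBits h2, ← bitEval_xor h2]
    exact bitEval_mem_span h2 hX hY hm
  · dsimp only
    rw [← bitEval_bigOrbitBits h2]
    exact bitEval_mem_span h2 hX hY (h1 p)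

end Bits

/-! ### Generators of the character ring of `(C₈ × C₈) ⋊ C₄` -/

section Fourier

variable {s : ZMod 8}

theorem pairing_comm (p v : A) : pairing p v = pairing v p := by
  unfold pairing
  ring

theorem sum_multiplicative (F : Multiplicative A → ℂ) :
    ∑ v, F v = ∑ v : A, F (Multiplicative.ofAdd v) :=
  (Equiv.sum_comp Multiplicative.ofAdd F).symm

/-- The multiplicity of the character with parameter `p` in the restriction of `f`. -/
noncomputable def coef (f : ZIrr (C8C4 s)) (p : A) : ℤ := avg (res (inlA s) f * lam (-p))

theorem coef_spec (f : ZIrr (C8C4 s)) (p : A) :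
    ∑ v : A, f.1 (el v 0) * ZMod.stdAddChar (-pairing p v) = 64 * (coef f p : ℂ) := by
  have h := avg_spec (res (inlA s) f * lam (-p))
  rw [sum_multiplicative] at h
  have hc : Nat.card (Multiplicative A) = 64 := by simp
  rw [hc, Nat.cast_ofNat] at h
  rw [coef, ← h]
  refine Finset.sum_congr rfl fun v _ => ?_
  rw [val_mul, lam_apply, pairing_neg_left]
  rfl

/-- Fourier inversion on A. -/
theorem apply_eq_sum_coef (f : ZIrr (C8C4 s)) (v : A) :
    f.1 (el v 0) = ∑ p, (coef f p : ℂ) * ZMod.stdAddChar (pairing p v) := by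
  have h : ∀ p, (coef f p : ℂ) = 64⁻¹ *
      ∑ w : A, f.1 (el w 0) * ZMod.stdAddChar (-pairing p w) := by
    intro p
    rw [coef_spec]
    ring
  have h1 : ∀ p, (coef f p : ℂ) * ZMod.stdAddChar (pairing p v) = 64⁻¹ *
      ∑ w : A, f.1 (el w 0) * ZMod.stdAddChar (pairing p (v - w)) := by
    intro p
    rw [h p, mul_assoc, Finset.sum_mul]
    congr 1
    refine Finset.sum_congr rfl fun w _ => ?_
    rw [mul_assoc, ← AddChar.map_add_eq_mul]
    congr 2
    simp only [pairing, Prod.fst_sub, Prod.snd_sub]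
    ring
  rw [Finset.sum_congr rfl fun p _ => h1 p, ← Finset.mul_sum, Finset.sum_comm]
  simp_rw [← Finset.mul_sum, sum_stdAddChar_pairing, sub_eq_zero]
  rw [Finset.sum_eq_single v]
  · rw [if_pos rfl]
    ring
  · intro w _ hw
    rw [if_neg hw.symm, mul_zero]
  · simp

theorem coef_of_invariant (f : ZIrr (C8C4 s)) (α : A ≃+ A) (δ : A → A)
    (hδ : ∀ p v, pairing p (α v) = pairing (δ p) v)
    (hf : ∀ v, f.1 (el (α v) 0) = f.1 (el v 0)) (p : A) : coef f (δ p) = coef f p := by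
  have h : (64 : ℂ) * (coef f (δ p) : ℂ) = 64 * (coef f p : ℂ) := by
    rw [← coef_spec, ← coef_spec, ← α.toEquiv.sum_comp fun v =>
      f.1 (el v 0) * ZMod.stdAddChar (-pairing p v)]
    refine Finset.sum_congr rfl fun v _ => ?_
    change _ = f.1 (el (α v) 0) * ZMod.stdAddChar (-pairing p (α v))
    rw [hf, hδ]
  have := mul_left_cancel₀ (by norm_num) h
  exact_mod_cast this

theorem coef_iterate_tDual (f : ZIrr (C8C4 s)) (p : A) (n : ℕ) :
    coef f ((tDual s)^[n] p) = coef f p := by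
  induction n with
  | zero => rfl
  | succ n ih =>
    rw [Function.iterate_succ_apply', ← ih]
    exact coef_of_invariant f (tAdd s) (tDual s) pairing_tAdd (fun v => apply_tAdd f v 0) _

/-- Representatives of the regular orbits of `⟨z, t⟩` on the dual of `C₈ × C₈`. -/
def freeReps (s : ZMod 8) : Finset A :=
  if s = 1 then {(0, 1), (0, 2), (0, 5), (1, 2), (1, 3)}
  else {(0, 1), (0, 2), (0, 3), (1, 1), (1, 4)}

/-- The action of `⟨z, t⟩` on the dual of `C₈ × C₈`. -/
def dualAct (s : ZMod 8) (x : A × Fin 3 × ZMod 4) : A :=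
  (tDual s)^[x.2.2.val] (zDual^[x.2.1.val] x.1)

/-- The five representatives give 5 · 12 = 60 parameters for the 64 - 4 = 60 points of the target.
So the surjectivity checked here also yields the injectivity needed in `sum_dualAct`. -/
theorem image_dualAct (hs : s = 1 ∨ s = 2) :
    (freeReps s ×ˢ Finset.univ).image (dualAct s) = Finset.univ.filter fun p : A => 2 * p ≠ 0 := by
  rcases hs with rfl | rfl <;> decide +kernel

theorem sum_dualAct (hs : s = 1 ∨ s = 2) (F : A → ℂ) :
    ∑ p ∈ freeReps s, ∑ i : Fin 3, ∑ l : ZMod 4, F ((tDual s)^[l.val] (zDual^[i.val] p)) =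
      ∑ p with 2 * p ≠ 0, F p := by
  have hinj : Set.InjOn (dualAct s) (freeReps s ×ˢ Finset.univ : Finset (A × Fin 3 × ZMod 4)) := by
    refine Finset.injOn_of_card_image_eq ?_
    rw [image_dualAct hs]
    rcases hs with rfl | rfl <;> decide +kernel
  rw [← image_dualAct hs, Finset.sum_image hinj, Finset.sum_product]
  refine Finset.sum_congr rfl fun p _ => ?_
  rw [Fintype.sum_prod_type]
  rfl

/-- The endomorphism 1 - t² is multiplication by -2 or 2, and it is divisible by 1 - t and by 1 -
t³. Therefore every class function is constant on the cosets of 2A outside A. -/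
theorem exists_two_mul_eq (hs : s = 1 ∨ s = 2) (l : ZMod 4) (hl : l ≠ 0) (w : A) :
    ∃ u, 2 * w = u - tPow s l u := by
  rcases hs with rfl | rfl <;> revert l w <;> decide +kernel

/-- A generalized character is the sum of a periodic one and of a combination of characters that
are induced from `C₈ × C₈`. -/
theorem exists_isPeriodic (hs : s = 1 ∨ s = 2) (f : ZIrr (C8C4 s)) : ∃ f₁, IsPeriodic f₁ ∧
    f = f₁ + ∑ p ∈ freeReps s, ∑ i : Fin 3,
      (coef f (zDual^[i.val] p) : ZIrr (C8C4 s)) * indA s (lam (zDual^[i.val] p)) ∧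
    (∀ v, f₁.1 (el v 0) =
      ∑ p with ¬ 2 * p ≠ 0, (coef f p : ℂ) * ZMod.stdAddChar (pairing p v)) ∧
    ∀ v l, l ≠ 0 → f₁.1 (el v l) = f.1 (el v l) := by
  set h := ∑ p ∈ freeReps s, ∑ i : Fin 3,
    (coef f (zDual^[i.val] p) : ZIrr (C8C4 s)) * indA s (lam (zDual^[i.val] p)) with hh
  have h0 : ∀ v, h.1 (el v 0) =
      ∑ p with 2 * p ≠ 0, (coef f p : ℂ) * ZMod.stdAddChar (pairing p v) := by
    intro v
    rw [hh, ← sum_dualAct hs, val_sum]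
    refine Finset.sum_congr rfl fun p _ => ?_
    rw [val_sum]
    refine Finset.sum_congr rfl fun i _ => ?_
    rw [val_mul, val_intCast, indA_apply_zero, Finset.mul_sum]
    refine Finset.sum_congr rfl fun l _ => ?_
    rw [lam_apply, pairing_tPow, coef_iterate_tDual]
  have hl : ∀ v l, l ≠ 0 → h.1 (el v l) = 0 := by
    intro v l hl
    rw [hh, val_sum]
    refine Finset.sum_eq_zero fun p _ => ?_
    rw [val_sum]
    refine Finset.sum_eq_zero fun i _ => ?_
    rw [val_mul, indA_apply_ne _ _ hl, mul_zero]
  have h1 : ∀ v, (f - h).1 (el v 0) =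
      ∑ p with ¬ 2 * p ≠ 0, (coef f p : ℂ) * ZMod.stdAddChar (pairing p v) := by
    intro v
    rw [val_sub, h0, apply_eq_sum_coef f, sub_eq_iff_eq_add, add_comm,
      Finset.sum_filter_add_sum_filter_not]
  refine ⟨f - h, ?_, (sub_add_cancel f h).symm, h1, ?_⟩
  -- On A only the Fourier terms with 2p = 0 remain, and these are constant on the cosets of 2A;
  -- outside A, conjugation by A suffices.
  · intro v w l
    by_cases hl0 : l = 0
    · subst hl0
      rw [h1, h1]
      refine Finset.sum_congr rfl fun p hp => ?_
      rw [pairing_two_mul (not_not.1 (Finset.mem_filter.1 hp).2)]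
    · obtain ⟨u, hu⟩ := exists_two_mul_eq hs l hl0 w
      rw [hu, ← add_sub_assoc, apply_add_sub]
  · intro v l hl0
    rw [val_sub, hl v l hl0, sub_zero]

/-! ### Generators of the ideals of even degrees -/

/-- The ideal generated by `2`, `τ - 1`, `μ - 1`, `ψ` and the characters induced from
`C₈ × C₈`. -/
noncomputable def bigIdeal (s : ZMod 8) : Ideal (ZIrr (C8C4 s)) :=
  Ideal.span ({2, tau s - 1, mu s - 1, psi s} ∪ Set.range fun p => indA s (lam p))

/-- The ideal generated by `2`, `τ - 1`, `μ - 1 + ψ` and the `z`-invariant characters induced from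
`C₈ × C₈`. -/
noncomputable def stableIdeal (s : ZMod 8) : Ideal (ZIrr (C8C4 s)) :=
  Ideal.span ({2, tau s - 1, mu s - 1 + psi s} ∪
    Set.range fun p => ∑ i : Fin 3, indA s (lam (zDual^[i.val] p)))

theorem deg_tau : deg (tau s) = 1 := by
  rw [deg_eq_iff]
  exact (tau_zero 0).trans (by simp)

theorem deg_mu : deg (mu s) = 1 := by
  rw [deg_eq_iff]
  exact (mu_zero 0).trans (by simp)

theorem deg_psi : deg (psi s) = 2 := by
  rw [deg_eq_iff]
  exact (psi_zero 0).trans (by simp)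

theorem deg_indA_lam (p : A) : deg (indA s (lam p)) = 4 := by
  rw [deg_eq_iff]
  refine (indA_apply_zero (lam p) 0).trans ?_
  have h : (lam p).1 1 = 1 := map_one (lamHom p)
  simp [tPow_zero_right, h]

/-- Comparison of degrees shows that `n` is even, hence itself in `I`. -/
theorem mem_of_sub_intCast_mem {G : Type} [Group G] {I : Ideal (ZIrr G)} (hI : I ≤ evenIdeal G)
    (h2 : (2 : ZIrr G) ∈ I) {f : ZIrr G} (hf : f ∈ evenIdeal G) (n : ℤ)
    (h : f - (n : ZIrr G) ∈ I) : f ∈ I := by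
  have h1 := mem_evenIdeal.1 (hI h)
  have h3 := mem_evenIdeal.1 hf
  rw [map_sub, map_intCast, Int.cast_id, Int.even_sub] at h1
  obtain ⟨k, hk⟩ := h1.1 h3
  have h4 : (n : ZIrr G) ∈ I := by
    rw [hk, ← two_mul]
    push_cast
    exact I.mul_mem_right _ h2
  simpa using add_mem h h4

theorem bigIdeal_le_evenIdeal : bigIdeal s ≤ evenIdeal (C8C4 s) := by
  refine Ideal.span_le.2 ?_
  rintro _ ((rfl | rfl | rfl | rfl) | ⟨p, rfl⟩) <;> refine mem_evenIdeal.2 ?_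
  · rw [map_ofNat]
    decide
  · simp [deg_tau]
  · simp [deg_mu]
  · simp [deg_psi]
  · rw [deg_indA_lam]
    decide

theorem stableIdeal_le_evenIdeal : stableIdeal s ≤ evenIdeal (C8C4 s) := by
  refine Ideal.span_le.2 ?_
  rintro _ ((rfl | rfl | rfl) | ⟨p, rfl⟩) <;> refine mem_evenIdeal.2 ?_
  · rw [map_ofNat]
    decide
  · simp [deg_tau]
  · simp [deg_mu, deg_psi]
  · simp only [map_sum, deg_indA_lam]
    decide

/-- Applied to the quotient by `bigIdeal s`, this says that modulo that ideal every generalized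
character is an integer. -/
theorem exists_map_eq_intCast (hs : s = 1 ∨ s = 2) {B : Type} [CommRing B]
    (q : ZIrr (C8C4 s) →+* B) (hτ : q (tau s) = 1) (hμ : q (mu s) = 1) (hψ : q (psi s) = 0)
    (hT : ∀ p, q (indA s (lam p)) = 0) (f : ZIrr (C8C4 s)) : ∃ n : ℤ, q f = n := by
  obtain ⟨f₁, hf₁, hff, -, -⟩ := exists_isPeriodic hs f
  obtain ⟨n, m, a, b, h1, -⟩ := hf₁.exists_eq hs
  refine ⟨n 0 + n 1 + n 2 + n 3 + (m 0 + m 1 + m 2 + m 3), ?_⟩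
  rw [hff, h1]
  simp only [map_add, map_mul, map_sum, map_intCast, map_pow, hτ, hμ, hψ, hT]
  push_cast
  simp

theorem evenIdeal_le_bigIdeal (hs : s = 1 ∨ s = 2) : evenIdeal (C8C4 s) ≤ bigIdeal s := by
  intro f hf
  have hgen : ∀ x ∈ ({2, tau s - 1, mu s - 1, psi s} ∪ Set.range fun p => indA s (lam p) :
      Set (ZIrr (C8C4 s))), Ideal.Quotient.mk (bigIdeal s) x = 0 := fun x hx =>
    Ideal.Quotient.eq_zero_iff_mem.2 (Ideal.subset_span hx)
  have hτ := hgen (tau s - 1) (by simp)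
  have hμ := hgen (mu s - 1) (by simp)
  rw [map_sub, map_one, sub_eq_zero] at hτ hμ
  obtain ⟨n, hn⟩ := exists_map_eq_intCast hs (Ideal.Quotient.mk (bigIdeal s)) hτ hμ
    (hgen _ (by simp)) (fun p => hgen _ (Or.inr ⟨p, rfl⟩)) f
  refine mem_of_sub_intCast_mem bigIdeal_le_evenIdeal (Ideal.subset_span (by simp)) hf n ?_
  rw [← Ideal.Quotient.eq_zero_iff_mem, map_sub, hn, map_intCast, sub_self]

/-- The generalized characters that are invariant under `z` on `C₈ × C₈` and on its coset by
`t ^ 2`. -/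
def IsStable (f : ZIrr (C8C4 s)) : Prop :=
  ∀ v l, l = 0 ∨ l = 2 → f.1 (el (zAdd v) l) = f.1 (el v l)

theorem pairing_zAdd (p v : A) : pairing p (zAdd v) = pairing (zDual p) v := by
  simp only [pairing, zDual, zAdd, AddEquiv.coe_mk, Equiv.coe_fn_mk]
  ring

theorem IsStable.coef_zDual {f : ZIrr (C8C4 s)} (hf : IsStable f) (p : A) :
    coef f (zDual p) = coef f p :=
  coef_of_invariant f zAdd zDual pairing_zAdd (fun v => hf v 0 (Or.inl rfl)) p

/-- The powers of `z` permute the three nontrivial cosets of 2A transitively. -/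
theorem IsPeriodic.apply_fixVec_eq (hs : s = 1 ∨ s = 2) {f : ZIrr (C8C4 s)} (hf : IsPeriodic f)
    {l : ZMod 4} (hl : ∀ v, f.1 (el (zAdd v) l) = f.1 (el v l)) :
    f.1 (el (fixVec s) l) = f.1 (el (1, 0) l) := by
  rcases hs with rfl | rfl
  · rw [show fixVec 1 = zAdd (1, 0) + 2 * (1, 0) by decide, hf, hl]
  · rw [show fixVec 2 = zAdd (zAdd (1, 0)) + 2 * (2, 1) by decide, hf, hl, hl]

/-- By stability the multiplicities of the induced characters are constant on `z`-orbits, so only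
`z`-sums occur. The total multiplicity of the τᵏμ equals that of ψ and τψ, so once τ becomes 1 only
multiples of μ + ψ, which becomes 1, are left besides integers. -/
theorem IsStable.exists_map_eq_intCast (hs : s = 1 ∨ s = 2) {B : Type} [CommRing B]
    (q : ZIrr (C8C4 s) →+* B) (hτ : q (tau s) = 1) (hμ : q (mu s) = 1 - q (psi s))
    (hT : ∀ p, ∑ i : Fin 3, q (indA s (lam (zDual^[i.val] p))) = 0) {f : ZIrr (C8C4 s)}
    (hf : IsStable f) : ∃ n : ℤ, q f = n := by
  obtain ⟨f₁, hf₁, hff, hf0, hfl⟩ := exists_isPeriodic hs f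
  have hb : Function.Bijective zDual := by
    rw [Fintype.bijective_iff_injective_and_card]
    refine ⟨fun p q h => ?_, rfl⟩
    obtain ⟨a, b⟩ := p
    obtain ⟨c, d⟩ := q
    simp only [zDual, Prod.mk.injEq] at h
    obtain ⟨rfl, h⟩ := h
    simpa using h
  -- The periodic part inherits the invariance on A: its Fourier coefficients are those of `f` at
  -- the points with 2p = 0, a set that `zDual` permutes.
  have hz : ∀ v, f₁.1 (el (zAdd v) 0) = f₁.1 (el v 0) := by
    intro v
    rw [hf0, hf0]
    refine Finset.sum_nbij zDual ?_ hb.injective.injOn ?_ ?_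
    · decide +kernel
    · rw [Set.SurjOn]
      intro q hq
      obtain ⟨p, rfl⟩ := hb.surjective q
      refine ⟨p, ?_, rfl⟩
      revert p
      simp only [Finset.coe_filter, Finset.mem_univ, true_and, Set.mem_ofPred_eq]
      decide +kernel
    · intro p _
      rw [pairing_zAdd, hf.coef_zDual]
  obtain ⟨n, m, a, b, h1, h2⟩ := hf₁.exists_eq hs
  obtain ⟨ha, hb'⟩ := h2 (hf₁.apply_fixVec_eq hs hz) (hf₁.apply_fixVec_eq hs fun v => by
    rw [hfl _ _ (by decide), hfl _ _ (by decide), hf v 2 (Or.inr rfl)])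
  have hcoef : ∀ p (i : ℕ), coef f (zDual^[i] p) = coef f p := by
    intro p i
    induction i with
    | zero => rfl
    | succ i ih => rw [Function.iterate_succ_apply', hf.coef_zDual, ih]
  refine ⟨n 0 + n 1 + n 2 + n 3 + (m 0 + m 1 + m 2 + m 3), ?_⟩
  rw [hff, h1]
  simp only [map_add, map_mul, map_sum, map_intCast, map_pow, hτ, hμ, hcoef, ← Finset.mul_sum, hT]
  rw [ha, hb']
  push_cast
  simp only [mul_zero, Finset.sum_const_zero]
  ring

theorem IsStable.mem_stableIdeal (hs : s = 1 ∨ s = 2) {f : ZIrr (C8C4 s)} (hf : IsStable f)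
    (hfe : f ∈ evenIdeal (C8C4 s)) : f ∈ stableIdeal s := by
  have hgen : ∀ x ∈ ({2, tau s - 1, mu s - 1 + psi s} ∪
      Set.range fun p => ∑ i : Fin 3, indA s (lam (zDual^[i.val] p)) :
      Set (ZIrr (C8C4 s))), Ideal.Quotient.mk (stableIdeal s) x = 0 := fun x hx =>
    Ideal.Quotient.eq_zero_iff_mem.2 (Ideal.subset_span hx)
  have hτ := hgen (tau s - 1) (by simp)
  rw [map_sub, map_one, sub_eq_zero] at hτ
  have hμ := hgen (mu s - 1 + psi s) (by simp)
  rw [map_add, map_sub, map_one] at hμ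
  obtain ⟨n, hn⟩ := hf.exists_map_eq_intCast hs (Ideal.Quotient.mk (stableIdeal s)) hτ
    (by linear_combination hμ)
    (fun p => by rw [← map_sum]; exact hgen _ (Or.inr ⟨p, rfl⟩))
  refine mem_of_sub_intCast_mem stableIdeal_le_evenIdeal (Ideal.subset_span (by simp)) hfe n ?_
  rw [← Ideal.Quotient.eq_zero_iff_mem, map_sub, hn, map_intCast, sub_self]

end Fourier

/-! ### Powers of the ideal of even degrees -/

section Powers

variable {s : ZMod 8}

theorem pow_le_span_two_of_map {R : Type*} [CommRing R] {I : Ideal R} {n : ℕ}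
    (h : (I.map (Ideal.Quotient.mk (Ideal.span {(2 : R)}))) ^ n = ⊥) :
    I ^ n ≤ Ideal.span {2} := by
  rw [← Ideal.map_pow, Ideal.map_eq_bot_iff_le_ker, Ideal.mk_ker] at h
  exact h

theorem quotient_two_eq_zero (R : Type*) [CommRing R] : (2 : R ⧸ Ideal.span {(2 : R)}) = 0 :=
  Ideal.Quotient.eq_zero_iff_mem.2 (Ideal.mem_span_singleton_self 2)

theorem tau_pow_four : tau s ^ 4 = 1 := by
  ext g
  obtain ⟨v, l, rfl⟩ := eq_el g
  rw [val_pow, tau_apply, val_one, ← pow_mul, mul_comm, pow_mul, Complex.I_pow_four, one_pow]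

theorem mu_sq : mu s ^ 2 = 1 := by
  ext g
  obtain ⟨v, l, rfl⟩ := eq_el g
  rw [val_pow, mu_apply, val_one, sq, ← AddChar.map_add_eq_mul, ← pairing_add_left,
    show muDual s + muDual s = 0 by revert s; decide]
  simp [pairing]

theorem psi_mul_tau_sq (hs : s = 1 ∨ s = 2) : psi s * tau s ^ 2 = psi s := by
  refine (isPeriodic_psi.mul (isPeriodic_tau.pow 2)).ext hs isPeriodic_psi ?_ ?_ ?_ <;>
    refine forall_zmod_four ?_ ?_ ?_ ?_ <;>
    simp [val_mul, val_pow, psi_zero, psi_fixVec, psi_one_zero, tau_zero, tau_one, tau_two,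
      tau_three, show (1 : ZMod 4) ≠ 2 by decide, show (1 : ZMod 4) ≠ 0 by decide, show (3 : ZMod 4) ≠ 0 by decide,
      show (3 : ZMod 4) ≠ 2 by decide]

theorem psi_mul_mu (hs : s = 1 ∨ s = 2) : psi s * mu s = psi s := by
  refine (isPeriodic_psi.mul isPeriodic_mu).ext hs isPeriodic_psi ?_ ?_ ?_ <;> intro l <;>
    simp [val_mul, mu_zero, mu_fixVec, psi_one_zero]

theorem psi_sq (hs : s = 1 ∨ s = 2) : psi s ^ 2 = (1 + tau s ^ 2) * (1 + mu s) := by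
  have h1 : IsPeriodic (1 : ZIrr (C8C4 s)) := fun _ _ _ => rfl
  refine (isPeriodic_psi.pow 2).ext hs ((h1.add (isPeriodic_tau.pow 2)).mul
    (h1.add isPeriodic_mu)) ?_ ?_ ?_ <;>
    refine forall_zmod_four ?_ ?_ ?_ ?_ <;>
    simp [val_mul, val_pow, val_add, val_one, psi_zero, psi_fixVec, psi_one_zero, tau_zero,
      tau_one, tau_two, tau_three, mu_zero, mu_fixVec, mu_one_zero,
      show (1 : ZMod 4) ≠ 2 by decide, show (1 : ZMod 4) ≠ 0 by decide, show (3 : ZMod 4) ≠ 0 by decide,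
      show (3 : ZMod 4) ≠ 2 by decide] <;> norm_num

/-- For x = τ - 1, y = μ - 1, w = ψ modulo 2. The successive powers of the ideal lie in those
generated by x², xy, xw, then x³, x²y, then x³y, then 0. -/
theorem span_triple_pow_eq_bot {B : Type*} [CommRing B] {x y w : B} (hx : x ^ 4 = 0)
    (hy : y ^ 2 = 0) (hw : w ^ 2 = x ^ 2 * y) (hwy : w * y = 0) (hwx : w * x ^ 2 = 0) :
    Ideal.span {x, y, w} ^ 5 = ⊥ := by
  have h2 : Ideal.span {x, y, w} ^ 2 ≤ Ideal.span {x ^ 2, x * y, x * w} := by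
    rw [sq, Ideal.span_mul_span', Ideal.span_le]
    rintro _ ⟨a, (rfl | rfl | rfl), b, (rfl | rfl | rfl), rfl⟩
    · exact Ideal.subset_span (by simp [sq])
    · exact Ideal.subset_span (by simp)
    · exact Ideal.subset_span (by simp)
    · exact Ideal.subset_span (by simp [mul_comm])
    · simp [← sq, hy]
    · simp [mul_comm a, hwy]
    · exact Ideal.subset_span (by simp [mul_comm])
    · simp [hwy]
    · simp only [SetLike.mem_coe, ← sq, hw]
      exact Ideal.mul_mem_right _ _ (Ideal.subset_span (by simp))
  have h3 : Ideal.span {x ^ 2, x * y, x * w} * Ideal.span {x, y, w} ≤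
      Ideal.span {x ^ 3, x ^ 2 * y} := by
    rw [Ideal.span_mul_span', Ideal.span_le]
    rintro _ ⟨a, (rfl | rfl | rfl), b, (rfl | rfl | rfl), rfl⟩ <;> dsimp only <;>
      rw [SetLike.mem_coe, Ideal.mem_span_pair]
    · exact ⟨1, 0, by ring⟩
    · exact ⟨0, 1, by ring⟩
    · exact ⟨0, 0, by linear_combination -hwx⟩
    · exact ⟨0, 1, by ring⟩
    · exact ⟨0, 0, by linear_combination -x * hy⟩
    · exact ⟨0, 0, by linear_combination -x * hwy⟩
    · exact ⟨0, 0, by linear_combination -hwx⟩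
    · exact ⟨0, 0, by linear_combination -x * hwy⟩
    · exact ⟨0, x, by linear_combination -x * hw⟩
  have h4 : Ideal.span {x ^ 3, x ^ 2 * y} * Ideal.span {x, y, w} ≤ Ideal.span {x ^ 3 * y} := by
    rw [Ideal.span_mul_span', Ideal.span_le]
    rintro _ ⟨a, (rfl | rfl), b, (rfl | rfl | rfl), rfl⟩ <;> dsimp only <;>
      rw [SetLike.mem_coe, Ideal.mem_span_singleton']
    · exact ⟨0, by linear_combination -hx⟩
    · exact ⟨1, by ring⟩
    · exact ⟨0, by linear_combination -x * hwx⟩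
    · exact ⟨1, by ring⟩
    · exact ⟨0, by linear_combination -x ^ 2 * hy⟩
    · exact ⟨0, by linear_combination -x ^ 2 * hwy⟩
  have h5 : Ideal.span {x ^ 3 * y} * Ideal.span {x, y, w} ≤ ⊥ := by
    rw [Ideal.span_mul_span', Ideal.span_le]
    rintro _ ⟨a, rfl, b, (rfl | rfl | rfl), rfl⟩ <;> dsimp only <;>
      rw [SetLike.mem_coe, Ideal.mem_bot]
    · linear_combination y * hx
    · linear_combination x ^ 3 * hy
    · linear_combination x ^ 3 * hwy
  rw [eq_bot_iff, show 5 = 2 + 1 + 1 + 1 from rfl, pow_add, pow_add, pow_add, pow_one]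
  exact (Ideal.mul_mono_left ((Ideal.mul_mono_left ((Ideal.mul_mono_left h2).trans h3)).trans
    h4)).trans h5

theorem lam_nsmul (n : ℕ) (p : A) : lam (n • p) = lam p ^ n := by
  induction n with
  | zero => rw [zero_smul, pow_zero, lam_zero]
  | succ n ih => rw [succ_nsmul, lam_add, ih, pow_succ]

theorem map_lam {B : Type} [CommRing B] (q : ZIrr (Multiplicative A) →+* B) (p : A) :
    q (lam p) = monoA (q (lam (1, 0))) (q (lam (0, 1))) p := by
  unfold monoA
  rw [← map_pow, ← map_pow, ← map_mul, ← lam_nsmul, ← lam_nsmul, ← lam_add]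
  congr 2
  ext <;> simp

theorem map_lam_pow_left {B : Type} [CommRing B] (q : ZIrr (Multiplicative A) →+* B) :
    q (lam (1, 0)) ^ 8 = 1 := by
  rw [← map_pow, ← lam_nsmul, show 8 • ((1, 0) : A) = 0 by decide, lam_zero, map_one]

theorem map_lam_pow_right {B : Type} [CommRing B] (q : ZIrr (Multiplicative A) →+* B) :
    q (lam (0, 1)) ^ 8 = 1 := by
  rw [← map_pow, ← lam_nsmul, show 8 • ((0, 1) : A) = 0 by decide, lam_zero, map_one]

theorem res_tau : res (inlA s) (tau s) = 1 := by
  ext v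
  exact tau_zero (s := s) v.toAdd

theorem res_mu : res (inlA s) (mu s) = lam (muDual s) := by
  ext v
  rfl

theorem res_psi : res (inlA s) (psi s) = lam (psiDual s 0) + lam (psiDual s 1) := by
  ext v
  exact (psi_apply (s := s) v.toAdd 0).trans (if_pos (Or.inl rfl))

theorem map_le_of_forall {R E : Type*} [CommRing R] [CommRing E] (r : R →+* E) {S : Set R}
    {J : Ideal E} (h : ∀ x ∈ S, r x ∈ J) : (Ideal.span S).map r ≤ J := by
  rw [Ideal.map_span, Ideal.span_le]
  rintro _ ⟨x, hx, rfl⟩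
  exact h x hx

theorem map_span_triple_pow (hs : s = 1 ∨ s = 2) {B : Type} [CommRing B]
    (q : ZIrr (C8C4 s) →+* B) (h2 : (2 : B) = 0) :
    (Ideal.span {tau s - 1, mu s - 1, psi s}).map q ^ 5 = ⊥ := by
  have e1 : q (tau s) ^ 4 = 1 := by rw [← map_pow, tau_pow_four, map_one]
  have e2 : q (mu s) ^ 2 = 1 := by rw [← map_pow, mu_sq, map_one]
  have e3 : q (psi s) * q (tau s) ^ 2 = q (psi s) := by
    rw [← map_pow, ← map_mul, psi_mul_tau_sq hs]
  have e4 : q (psi s) * q (mu s) = q (psi s) := by rw [← map_mul, psi_mul_mu hs]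
  have e5 : q (psi s) ^ 2 = (1 + q (tau s) ^ 2) * (1 + q (mu s)) := by
    rw [← map_pow, psi_sq hs, map_mul, map_add, map_add, map_one, map_pow]
  have hmap : (Ideal.span {tau s - 1, mu s - 1, psi s}).map q ≤
      Ideal.span {q (tau s) - 1, q (mu s) - 1, q (psi s)} := by
    refine map_le_of_forall q ?_
    rintro _ (rfl | rfl | rfl)
    · exact Ideal.subset_span (by simp)
    · exact Ideal.subset_span (by simp)
    · exact Ideal.subset_span (by simp)
  refine eq_bot_iff.2 ((Ideal.pow_right_mono hmap 5).trans (le_of_eq ?_))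
  generalize q (tau s) = a at *
  generalize q (mu s) = b at *
  generalize q (psi s) = w at *
  refine span_triple_pow_eq_bot ?_ ?_ ?_ ?_ ?_
  · linear_combination e1 + (-2 * a ^ 3 + 3 * a ^ 2 - 2 * a + 1) * h2
  · linear_combination e2 + (1 - b) * h2
  · linear_combination e5 + (1 + a ^ 2 + a * b - a) * h2
  · linear_combination e4
  · linear_combination e3 + (w - w * a) * h2

/-- Modulo 2 the elements x = τ - 1 and y = μ - 1 + ψ satisfy x⁴ = 0 and y² = x²y, since ψ² = x²(μ -
1) and x²ψ = 0. All monomials of degree 5 then vanish. -/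
theorem map_span_pair_pow (hs : s = 1 ∨ s = 2) {B : Type} [CommRing B]
    (q : ZIrr (C8C4 s) →+* B) (h2 : (2 : B) = 0) :
    (Ideal.span {tau s - 1, mu s - 1 + psi s}).map q ^ 5 = ⊥ := by
  have e1 : q (tau s) ^ 4 = 1 := by rw [← map_pow, tau_pow_four, map_one]
  have e2 : q (mu s) ^ 2 = 1 := by rw [← map_pow, mu_sq, map_one]
  have e3 : q (psi s) * q (tau s) ^ 2 = q (psi s) := by
    rw [← map_pow, ← map_mul, psi_mul_tau_sq hs]
  have e4 : q (psi s) * q (mu s) = q (psi s) := by rw [← map_mul, psi_mul_mu hs]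
  have e5 : q (psi s) ^ 2 = (1 + q (tau s) ^ 2) * (1 + q (mu s)) := by
    rw [← map_pow, psi_sq hs, map_mul, map_add, map_add, map_one, map_pow]
  have hmap : (Ideal.span {tau s - 1, mu s - 1 + psi s}).map q ≤
      Ideal.span {q (tau s) - 1, q (mu s) - 1 + q (psi s)} := by
    refine map_le_of_forall q ?_
    rintro _ (rfl | rfl)
    · exact Ideal.subset_span (by simp)
    · exact Ideal.subset_span (by simp)
  refine eq_bot_iff.2 ((Ideal.pow_right_mono hmap 5).trans (le_of_eq ?_))
  generalize q (tau s) = a at *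
  generalize q (mu s) = b at *
  generalize q (psi s) = w at *
  have hx : (a - 1) ^ 4 = 0 := by
    linear_combination e1 + (-2 * a ^ 3 + 3 * a ^ 2 - 2 * a + 1) * h2
  have hy : (b - 1 + w) ^ 2 = (a - 1) ^ 2 * (b - 1 + w) := by
    linear_combination e2 + 2 * e4 + e5 - e3 + (2 - b - w + a ^ 2 + a * b - a + a * w) * h2
  generalize a - 1 = x at hx hy ⊢
  generalize b - 1 + w = y at hx hy ⊢
  refine span_pair_pow_eq_bot fun i hi => ?_
  interval_cases i
  · linear_combination (y ^ 3 + x ^ 2 * y ^ 2 + x ^ 4 * y) * hy + (x ^ 2 * y ^ 2) * hx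
  · linear_combination (x * y ^ 2 + x ^ 3 * y) * hy + x * y ^ 2 * hx
  · linear_combination x ^ 2 * y * hy + y ^ 2 * hx
  · linear_combination x ^ 3 * hy + x * y * hx
  · linear_combination y * hx
  · linear_combination x * hx

theorem map_bigIdeal_pow (hs : s = 1 ∨ s = 2) {B : Type} [CommRing B]
    (q : ZIrr (Multiplicative A) →+* B) (h2 : (2 : B) = 0) :
    (bigIdeal s).map (q.comp (res (inlA s))) ^ 5 = ⊥ := by
  refine eq_bot_iff.2 (le_trans (Ideal.pow_right_mono ?_ 5)
    (span_orbit_pow_eq_bot hs h2 (map_lam_pow_left q) (map_lam_pow_right q)).le)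
  refine map_le_of_forall _ ?_
  rintro _ ((rfl | rfl | rfl | rfl) | ⟨p, rfl⟩)
  · rw [map_ofNat, h2]
    exact zero_mem _
  · rw [RingHom.comp_apply, map_sub, res_tau, map_one, sub_self, map_zero]
    exact zero_mem _
  · refine Ideal.subset_span (Or.inl (Or.inl ?_))
    rw [RingHom.comp_apply, map_sub, res_mu, map_one, map_sub, map_lam, map_one]
  · refine Ideal.subset_span (Or.inl (Or.inr ?_))
    rw [RingHom.comp_apply, res_psi, map_add]
    exact congrArg₂ (· + ·) (map_lam q _) (map_lam q _)
  · refine Ideal.subset_span (Or.inr ⟨p, ?_⟩)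
    dsimp only
    rw [RingHom.comp_apply, res_indA_lam, map_sum]
    exact Finset.sum_congr rfl fun l _ => (map_lam q _).symm

theorem map_stableIdeal_pow (hs : s = 1 ∨ s = 2) {B : Type} [CommRing B]
    (q : ZIrr (Multiplicative A) →+* B) (h2 : (2 : B) = 0) :
    (stableIdeal s).map (q.comp (res (inlA s))) ^ 4 = ⊥ := by
  refine eq_bot_iff.2 (le_trans (Ideal.pow_right_mono ?_ 4)
    (span_bigOrbit_pow_eq_bot hs h2 (map_lam_pow_left q) (map_lam_pow_right q)).le)
  refine map_le_of_forall _ ?_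
  rintro _ ((rfl | rfl | rfl) | ⟨p, rfl⟩)
  · rw [map_ofNat, h2]
    exact zero_mem _
  · rw [RingHom.comp_apply, map_sub, res_tau, map_one, sub_self, map_zero]
    exact zero_mem _
  · refine Ideal.subset_span (Or.inl ?_)
    rw [RingHom.comp_apply, map_add, map_sub, res_mu, res_psi, map_one, map_add, map_sub, map_one,
      map_add]
    exact congrArg₂ (· + ·) (congrArg (· - 1) (map_lam q _))
      (congrArg₂ (· + ·) (map_lam q _) (map_lam q _))
  · refine Ideal.subset_span (Or.inr ⟨p, ?_⟩)
    dsimp only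
    rw [RingHom.comp_apply, map_sum, map_sum]
    refine Finset.sum_congr rfl fun i _ => ?_
    rw [res_indA_lam, map_sum]
    exact Finset.sum_congr rfl fun l _ => (map_lam q _).symm

theorem bigIdeal_pow_le (hs : s = 1 ∨ s = 2) : bigIdeal s ^ 6 ≤ Ideal.span {2} := by
  refine pow_le_span_two (res (inlA s)) (indA s) indA_mul_res
    (K := Ideal.span {tau s - 1, mu s - 1, psi s}) ?_ ?_ (n := 5) ?_ ?_
  · refine Ideal.span_le.2 ?_
    rintro _ ((rfl | rfl | rfl | rfl) | ⟨p, rfl⟩)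
    · exact Ideal.mem_sup_right (Ideal.mem_span_singleton_self _)
    · exact Ideal.mem_sup_left (Ideal.mem_sup_left (Ideal.subset_span (by simp)))
    · exact Ideal.mem_sup_left (Ideal.mem_sup_left (Ideal.subset_span (by simp)))
    · exact Ideal.mem_sup_left (Ideal.mem_sup_left (Ideal.subset_span (by simp)))
    · exact Ideal.mem_sup_left (Ideal.mem_sup_right ⟨lam p, trivial, rfl⟩)
  · refine Ideal.span_mono ?_
    rintro _ (rfl | rfl | rfl)
    · exact Or.inl (by simp)
    · exact Or.inl (by simp)
    · exact Or.inl (by simp)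
  · refine (Ideal.pow_le_pow_right (show 5 ≤ 6 by norm_num)).trans (pow_le_span_two_of_map ?_)
    exact map_span_triple_pow hs _ (quotient_two_eq_zero _)
  · refine pow_le_span_two_of_map ?_
    rw [Ideal.map_map]
    exact map_bigIdeal_pow hs _ (quotient_two_eq_zero _)

theorem stableIdeal_pow_le (hs : s = 1 ∨ s = 2) : stableIdeal s ^ 5 ≤ Ideal.span {2} := by
  refine pow_le_span_two (res (inlA s)) (indA s) indA_mul_res
    (K := Ideal.span {tau s - 1, mu s - 1 + psi s}) ?_ ?_ (n := 4) ?_ ?_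
  · refine Ideal.span_le.2 ?_
    rintro _ ((rfl | rfl | rfl) | ⟨p, rfl⟩)
    · exact Ideal.mem_sup_right (Ideal.mem_span_singleton_self _)
    · exact Ideal.mem_sup_left (Ideal.mem_sup_left (Ideal.subset_span (by simp)))
    · exact Ideal.mem_sup_left (Ideal.mem_sup_left (Ideal.subset_span (by simp)))
    · refine Ideal.mem_sup_left (Ideal.mem_sup_right (Ideal.sum_mem _ fun i _ => ?_))
      exact ⟨lam (zDual^[i.val] p), trivial, rfl⟩
  · refine Ideal.span_mono ?_
    rintro _ (rfl | rfl)
    · exact Or.inl (by simp)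
    · exact Or.inl (by simp)
  · refine pow_le_span_two_of_map ?_
    exact map_span_pair_pow hs _ (quotient_two_eq_zero _)
  · refine pow_le_span_two_of_map ?_
    rw [Ideal.map_map]
    exact map_stableIdeal_pow hs _ (quotient_two_eq_zero _)

theorem evenIdeal_pow_le (hs : s = 1 ∨ s = 2) : evenIdeal (C8C4 s) ^ 6 ≤ Ideal.span {2} :=
  (Ideal.pow_right_mono (evenIdeal_le_bigIdeal hs) 6).trans (bigIdeal_pow_le hs)

/-! ### Products with odd average -/

theorem avg_lam (p : A) : avg (lam p) = if p = 0 then 1 else 0 := by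
  rw [avg_eq_iff, sum_multiplicative]
  simp_rw [lam_apply, pairing_comm p]
  rw [sum_stdAddChar_pairing]
  split_ifs <;> simp

/-- Frobenius reciprocity for the trivial character. -/
theorem avg_indA (a : ZIrr (Multiplicative A)) : avg (indA s a) = avg a := by
  rw [avg_eq_iff, card_C8C4, sum_C8C4]
  have h := avg_spec a
  rw [sum_multiplicative] at h
  have hc : Nat.card (Multiplicative A) = 64 := by simp
  rw [hc] at h
  rw [Finset.sum_eq_single 0]
  · simp_rw [indA_apply_zero]
    rw [Finset.sum_comm]
    have hl : ∀ l : ZMod 4, ∑ v : A, a.1 (Multiplicative.ofAdd (tPow s l v)) =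
        ∑ v : A, a.1 (Multiplicative.ofAdd v) := by
      intro l
      have hb : Function.Bijective (tPow s l) := (tAdd s).bijective.iterate l.val
      exact hb.sum_comp fun v => a.1 (Multiplicative.ofAdd v)
    simp_rw [hl, h]
    simp
    ring
  · intro l _ hl
    exact Finset.sum_eq_zero fun v _ => indA_apply_ne a v hl
  · simp

/-- The number of ways to write `-p` as a sum of elements of the orbits of the `q i`. -/
def orbitCount (s : ZMod 8) (p q₁ q₂ q₃ q₄ : A) : ℤ :=
  ∑ l : ZMod 4, ∑ k : ZMod 4, ∑ j : ZMod 4, ∑ i : ZMod 4,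
    if p + ((tDual s)^[i.val] q₁ + ((tDual s)^[j.val] q₂ + ((tDual s)^[k.val] q₃ +
      (tDual s)^[l.val] q₄))) = 0 then 1 else 0

/-- The projection formula and Frobenius reciprocity move the average to A, where Mackey's formula
turns the other four factors into orbit sums. -/
theorem avg_prod_indA (p q₁ q₂ q₃ q₄ : A) : avg (indA s (lam p) * (indA s (lam q₁) *
    (indA s (lam q₂) * (indA s (lam q₃) * indA s (lam q₄))))) = orbitCount s p q₁ q₂ q₃ q₄ := by
  rw [← indA_mul_res, avg_indA]
  simp only [map_mul, res_indA_lam, Finset.sum_mul, Finset.mul_sum, ← lam_add, map_sum, avg_lam]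
  rfl

theorem exists_odd_avg (hs : s = 1 ∨ s = 2) :
    ∃ f ∈ evenIdeal (C8C4 s) ^ 5, Odd (avg f) := by
  have he : ∀ p, indA s (lam p) ∈ evenIdeal (C8C4 s) := fun p => mem_evenIdeal.2 (by
    rw [deg_indA_lam]
    decide)
  have hm : ∀ p q₁ q₂ q₃ q₄ : A, indA s (lam p) * (indA s (lam q₁) *
      (indA s (lam q₂) * (indA s (lam q₃) * indA s (lam q₄)))) ∈ evenIdeal (C8C4 s) ^ 5 := by
    intro p q₁ q₂ q₃ q₄
    rw [show 5 = 1 + (1 + (1 + (1 + 1))) from rfl, pow_add, pow_add, pow_add, pow_add, pow_one]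
    exact Ideal.mul_mem_mul (he _) (Ideal.mul_mem_mul (he _) (Ideal.mul_mem_mul (he _)
      (Ideal.mul_mem_mul (he _) (he _))))
  rcases hs with rfl | rfl
  -- Five explicit orbits for which the number of zero sums is odd; the parity is checked by
  -- enumeration.
  · refine ⟨_, hm (0, 1) (0, 1) (0, 1) (1, 0) (1, 3), ?_⟩
    rw [avg_prod_indA]
    decide +kernel
  · refine ⟨_, hm (0, 1) (0, 1) (0, 1) (1, 0) (1, 1), ?_⟩
    rw [avg_prod_indA]
    decide +kernel

/-- The parity of the average of `(τ - 1) ^ 3 g` is the one of the average of the restriction of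
`g`. -/
theorem odd_avg_tau_sub_one_pow_mul (g : ZIrr (C8C4 s)) (h : Odd (avg (res (inlA s) g))) :
    Odd (avg ((tau s - 1) ^ 3 * g)) := by
  have h1 : indA s 1 = 1 + tau s + tau s ^ 2 + tau s ^ 3 := by
    ext x
    obtain ⟨v, l, rfl⟩ := eq_el x
    by_cases hl : l = 0
    · subst hl
      rw [indA_apply_zero]
      simp only [val_one, val_add, val_pow, tau_zero]
      norm_num
    · rw [indA_apply_ne _ _ hl]
      revert l
      refine forall_zmod_four ?_ ?_ ?_ ?_ <;> intro hl
      · exact absurd rfl hl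
      · simp [val_one, val_add, val_pow, tau_one, Complex.I_pow_three]
      · simp only [val_one, val_add, val_pow, tau_two]
        norm_num
      · simp [val_one, val_add, val_pow, tau_three, Odd.neg_pow (show Odd 3 by decide),
          Complex.I_pow_three]
  -- Modulo 2, (τ - 1)³ is 1 + τ + τ² + τ³, the character induced from the trivial character of A.
  have h2 : (tau s - 1) ^ 3 * g = indA s (res (inlA s) g) +
      2 • ((-2 * tau s ^ 2 + tau s - 1) * g) := by
    rw [← one_mul (res (inlA s) g), indA_mul_res, h1, two_nsmul]
    ring
  rw [h2, map_add, map_nsmul, avg_indA, nsmul_eq_mul, Nat.cast_ofNat]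
  exact h.add_even (even_two_mul _)

end Powers

/-! ### Subgroups of index `1` or `3` -/

section Injective

theorem evenIdeal_le_comap_res {G H : Type} [Group G] [Group H] (φ : H →* G) :
    evenIdeal G ≤ (evenIdeal H).comap (res φ) := fun f hf => by
  rw [Ideal.mem_comap, mem_evenIdeal, deg_res]
  exact mem_evenIdeal.1 hf

variable {G Q : Type} [Group G] [Finite G] [Group Q] {j : Q →* G}
  (O : Type*) [CommRing O] [IsDomain O] [CharZero O] [IsLocalRing O]
  [CharP (IsLocalRing.ResidueField O) 2]

theorem existsUnique_isCharFun_of_injective (hj : Function.Injective j) (hQ : IsPGroup 2 Q)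
    (hi : j.range.index = 1 ∨ j.range.index = 3) :
    ∃! e : Irr G O, IsCharFun (pElements 2 G) e := by
  classical
  cases nonempty_fintype (G ⧸ j.range)
  refine existsUnique_isCharFun (InductionData.ofInjective j hj)
    (InductionData.isConj_ofInjective j hj) hQ ?_ O
  rwa [← Nat.card_eq_fintype_card]

theorem loewyLength_principalBlock_of_injective [Fintype Q] (hj : Function.Injective j)
    (hQ : IsPGroup 2 Q) (hi : j.range.index = 1 ∨ j.range.index = 3) (n : ℕ)
    (hup : evenIdeal G ^ (n + 1) ≤ (Ideal.span {2}).comap (res j))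
    (hlow : ∃ f ∈ evenIdeal G ^ n, Odd (avg (res j f))) :
    loewyLength (PrincipalBlock O 2 G) = n + 1 := by
  classical
  cases nonempty_fintype (G ⧸ j.range)
  refine loewyLength_principalBlock (InductionData.ofInjective j hj)
    (InductionData.isConj_ofInjective j hj) hQ ?_ O n hup hlow
  rwa [← Nat.card_eq_fintype_card]

end Injective

/-! ### The affine permutation character of a semidirect product -/

section Affine

variable {K H : Type} [Group K] [Group H] (φ : H →* MulAut K)

/-- The action of `K ⋊ H` on `K` by affine maps. -/
def InductionData.affine : InductionData Unit (K ⋊[φ] H) K where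
  act :=
    { toFun g := (φ g.right).toEquiv.trans (Equiv.mulLeft g.left)
      map_one' := by ext x; simp
      map_mul' g h := by ext x; simp }
  c _ _ := 1
  c_mul _ _ _ := rfl

variable [Fintype K] [DecidableEq K]

/-- On `K` the affine action is by left translations, so this restriction is the regular character.
-/
theorem InductionData.ind_affine_inl (k : K) :
    ((InductionData.affine φ).ind 1).1 (SemidirectProduct.inl k) =
      if k = 1 then (Nat.card K : ℂ) else 0 := by
  rw [InductionData.ind_one_apply]
  have h : ∀ x, (InductionData.affine φ).act (SemidirectProduct.inl k) x = x ↔ k = 1 := by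
    intro x
    change k * φ 1 x = x ↔ k = 1
    simp
  simp_rw [h]
  split_ifs with hk <;> simp [hk]

end Affine

/-! ### The group `(C₈ × C₈) ⋊ C₃ ⋊ C₄` and its Sylow `2`-subgroups -/

section Main

variable {s : ZMod 8}

theorem card_N : Nat.card N = 192 := by
  rw [SemidirectProduct.card]
  simp

theorem card_C8C3C4 : Nat.card (C8C3C4 s) = 768 := by
  rw [SemidirectProduct.card, card_N]
  simp

theorem isPGroup_C8C4 : IsPGroup 2 (C8C4 s) :=
  IsPGroup.of_card (n := 8) (by rw [card_C8C4]; norm_num)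

/-- The inclusion of `(C₈ × C₈) ⋊ C₄` in `(C₈ × C₈) ⋊ C₃ ⋊ C₄`. -/
def inclSylow (s : ZMod 8) : C8C4 s →* C8C3C4 s :=
  SemidirectProduct.map SemidirectProduct.inl (MonoidHom.id _) (by
    intro l
    refine MonoidHom.ext fun v => ?_
    change SemidirectProduct.inl ((tAut s ^ _) v) = (tN s ^ _) (SemidirectProduct.inl v)
    generalize (Multiplicative.toAdd l).val = n
    induction n generalizing v with
    | zero => rfl
    | succ n ih =>
      rw [pow_succ, pow_succ, MulAut.mul_apply, MulAut.mul_apply, ih]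
      exact congrArg (tN s ^ n) (SemidirectProduct.ext rfl inv_one.symm))

theorem inclSylow_el (v : A) (l : ZMod 4) : inclSylow s (el v l) =
    ⟨⟨Multiplicative.ofAdd v, 1⟩, Multiplicative.ofAdd l⟩ := rfl

theorem inclSylow_injective : Function.Injective (inclSylow s) := by
  intro x y h
  obtain ⟨v, l, rfl⟩ := eq_el x
  obtain ⟨w, m, rfl⟩ := eq_el y
  rw [inclSylow_el, inclSylow_el] at h
  have h1 : v = w := congrArg (fun g : C8C3C4 s => g.left.left.toAdd) h
  have h2 : l = m := congrArg (fun g : C8C3C4 s => g.right.toAdd) h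
  rw [h1, h2]

theorem card_range_inclSylow : Nat.card (inclSylow s).range = 256 := by
  rw [← card_C8C4 (s := s)]
  exact (Nat.card_congr (MonoidHom.ofInjective inclSylow_injective).toEquiv).symm

theorem index_range_inclSylow : (inclSylow s).range.index = 3 := by
  have h := (inclSylow s).range.card_mul_index
  rw [card_range_inclSylow, card_C8C3C4] at h
  lia

/-- The generator of `C₃`. -/
def genC3 (s : ZMod 8) : C8C3C4 s := ⟨⟨1, Multiplicative.ofAdd 1⟩, 1⟩

theorem cyclicHom_tN_two (x : N) :
    cyclicHom 4 (tN s) (tN_pow s) (Multiplicative.ofAdd 2) x =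
      ⟨tAut s (tAut s x.left), x.right⟩ := by
  ext1
  · rfl
  · exact inv_inv x.right

theorem zAut_ofAdd (v : A) :
    actC3 (Multiplicative.ofAdd 1) (Multiplicative.ofAdd v) = Multiplicative.ofAdd (zAdd v) := rfl

/-- Since `t` inverts `z`, even powers of `t` commute with `z`, and conjugation by `z` acts on A
alone. -/
theorem genC3_mul (v : A) {l : ZMod 4} (hl : l = 0 ∨ l = 2) :
    genC3 s * inclSylow s (el v l) = inclSylow s (el (zAdd v) l) * genC3 s := by
  have hl' : cyclicHom 4 (tN s) (tN_pow s) (Multiplicative.ofAdd l)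
      ⟨1, Multiplicative.ofAdd 1⟩ = ⟨1, Multiplicative.ofAdd 1⟩ := by
    rcases hl with rfl | rfl
    · rw [ofAdd_zero, map_one, MulAut.one_apply]
    · rw [cyclicHom_tN_two, map_one, map_one]
  refine SemidirectProduct.ext ?_ (mul_comm _ _)
  change (⟨1, Multiplicative.ofAdd 1⟩ : N) * cyclicHom 4 (tN s) (tN_pow s) 1
    ⟨Multiplicative.ofAdd v, 1⟩ = ⟨Multiplicative.ofAdd (zAdd v), 1⟩ *
    cyclicHom 4 (tN s) (tN_pow s) (Multiplicative.ofAdd l) ⟨1, Multiplicative.ofAdd 1⟩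
  rw [hl', map_one (cyclicHom 4 (tN s) (tN_pow s)), MulAut.one_apply, SemidirectProduct.mul_def,
    SemidirectProduct.mul_def]
  dsimp only
  rw [zAut_ofAdd, map_one actC3, one_mul, mul_one, one_mul, MulAut.one_apply, mul_one]

theorem isStable_res (f : ZIrr (C8C3C4 s)) : IsStable (res (inclSylow s) f) := by
  intro v l hl
  rw [res_apply, res_apply, ← apply_conj f.2 (inclSylow s (el v l)) (genC3 s), genC3_mul v hl, mul_inv_cancel_right]

theorem evenIdeal_le_comap_stableIdeal (hs : s = 1 ∨ s = 2) :
    evenIdeal (C8C3C4 s) ≤ (stableIdeal s).comap (res (inclSylow s)) := fun f hf =>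
  (isStable_res f).mem_stableIdeal hs (evenIdeal_le_comap_res _ hf)

theorem evenIdeal_pow_le_comap (hs : s = 1 ∨ s = 2) :
    evenIdeal (C8C3C4 s) ^ 5 ≤ (Ideal.span {2}).comap (res (inclSylow s)) :=
  ((Ideal.pow_right_mono (evenIdeal_le_comap_stableIdeal hs) 5).trans
    (Ideal.le_comap_pow _ 5)).trans (Ideal.comap_mono (stableIdeal_pow_le hs))

/-- The factor (τ - 1)³ reduces the parity to an average over A. There the affine permutation
character of degree 192 = 3 · 64 is three times the regular character, so its average is 3. -/
theorem exists_odd_avg_res : ∃ f ∈ evenIdeal (C8C3C4 s) ^ 4, Odd (avg (res (inclSylow s) f)) := by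
  classical
  cases nonempty_fintype N
  let D := InductionData.affine (cyclicHom 4 (tN s) (tN_pow s))
  let τ : ZIrr (C8C3C4 s) :=
    linearChar ((cyclicHom 4 Complex.I Complex.I_pow_four).comp SemidirectProduct.rightHom)
  have hτ : res (inclSylow s) τ = tau s := rfl
  have hD : deg (D.ind 1) = 192 := by
    rw [deg_eq_iff]
    refine (InductionData.ind_affine_inl _ 1).trans ?_
    rw [if_pos rfl, card_N]
    norm_num
  refine ⟨(τ - 1) ^ 3 * D.ind 1, ?_, ?_⟩
  · rw [pow_succ (evenIdeal _) 3]
    refine Ideal.mul_mem_mul (Ideal.pow_mem_pow ?_ 3) ?_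
    · rw [mem_evenIdeal, map_sub, map_one, ← deg_res (inclSylow s), hτ, deg_tau]
      decide
    · rw [mem_evenIdeal, hD]
      decide
  · rw [map_mul, map_pow, map_sub, hτ, map_one]
    refine odd_avg_tau_sub_one_pow_mul _ ?_
    have h : avg (res (inlA s) (res (inclSylow s) (D.ind 1))) = 3 := by
      rw [avg_eq_iff, Finset.sum_eq_single 1]
      · rw [res_apply, map_one (inlA s), res_apply, map_one (inclSylow s)]
        refine (InductionData.ind_affine_inl _ 1).trans ?_
        rw [if_pos rfl, card_N]
        simp
        norm_num
      · intro v _ hv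
        refine (InductionData.ind_affine_inl _ (SemidirectProduct.inl v)).trans (if_neg ?_)
        rwa [← map_one SemidirectProduct.inl, SemidirectProduct.inl_inj]
      · simp
    rw [h]
    decide

/-- The conjugate of `t` by `z` has a nontrivial component in `C₃`, because `t` inverts `z`. -/
theorem not_normal_range_inclSylow : ¬ (inclSylow s).range.Normal := by
  intro h
  obtain ⟨x, hx⟩ := h.conj_mem _ ⟨el 0 1, rfl⟩ (genC3 s)
  rw [eq_mul_inv_iff_mul_eq] at hx
  obtain ⟨v, l, rfl⟩ := eq_el x
  have h2 : l = 1 := by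
    have := congrArg (fun g : C8C3C4 s => g.right.toAdd) hx
    simpa [inclSylow_el, genC3] using this
  subst h2
  have h1 : (1 * (Multiplicative.ofAdd 1)⁻¹ : Multiplicative (ZMod 3)) =
      Multiplicative.ofAdd 1 * 1 := congrArg (fun g : C8C3C4 s => g.left.right) hx
  revert h1
  decide

/-- The Sylow `2`-subgroup `(C₈ × C₈) ⋊ C₄`. -/
def sylowTwo (s : ZMod 8) : Sylow 2 (C8C3C4 s) :=
  (IsPGroup.of_equiv isPGroup_C8C4 (MonoidHom.ofInjective inclSylow_injective)).toSylow (by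
    rw [index_range_inclSylow]
    decide)

theorem card_sylow (P : Sylow 2 (C8C3C4 s)) : Nat.card P = 256 := by
  rw [Nat.card_congr (P.equiv (sylowTwo s)).toEquiv]
  exact card_range_inclSylow

/-- The index 3 is prime, so the normalizer is `P` or everything. In the latter case the Sylow
2-subgroup would be unique and normal. -/
theorem normalizer_eq (P : Sylow 2 (C8C3C4 s)) :
    Subgroup.normalizer (P : Set (C8C3C4 s)) = P := by
  have hle : (P : Subgroup (C8C3C4 s)) ≤ Subgroup.normalizer (P : Set (C8C3C4 s)) :=
    Subgroup.le_normalizer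
  have h1 := Subgroup.card_dvd_of_le hle
  have h2 := Subgroup.card_subgroup_dvd_card (Subgroup.normalizer (P : Set (C8C3C4 s)))
  rw [show Nat.card (P : Subgroup (C8C3C4 s)) = 256 from card_sylow P] at h1
  rw [card_C8C3C4] at h2
  obtain ⟨k, hk⟩ := h1
  rw [hk, show 768 = 256 * 3 from rfl] at h2
  rcases (Nat.dvd_prime Nat.prime_three).1 (Nat.dvd_of_mul_dvd_mul_left (by norm_num) h2)
    with rfl | rfl
  · refine (Subgroup.eq_of_le_of_card_ge hle ?_).symm
    rw [hk]
    exact (card_sylow P).ge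
  · have htop : Subgroup.normalizer (P : Set (C8C3C4 s)) = ⊤ :=
      Subgroup.eq_top_of_card_eq _ (by rw [hk, card_C8C3C4])
    have hP : (P : Subgroup (C8C3C4 s)).Normal := Subgroup.normalizer_eq_top_iff.1 htop
    have := Sylow.unique_of_normal P hP
    have heq : P = sylowTwo s := Subsingleton.elim _ _
    rw [heq] at hP
    exact absurd hP not_normal_range_inclSylow

theorem nonempty_mulEquiv_normalizer (P : Sylow 2 (C8C3C4 s)) :
    Nonempty (C8C4 s ≃* Subgroup.normalizer (P : Set (C8C3C4 s))) :=
  ⟨((MonoidHom.ofInjective inclSylow_injective).trans ((sylowTwo s).equiv P)).trans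
    (MulEquiv.subgroupCongr (normalizer_eq P).symm)⟩

theorem isSolvable_semidirectProduct {K H : Type} [Group K] [Group H] (φ : H →* MulAut K)
    [Group.IsSolvable K] [Group.IsSolvable H] : Group.IsSolvable (K ⋊[φ] H) :=
  Group.isSolvable_of_ker_le_range SemidirectProduct.inl SemidirectProduct.rightHom
    SemidirectProduct.range_inl_eq_ker_rightHom.ge

theorem isSolvable_C8C3C4 : Group.IsSolvable (C8C3C4 s) := by
  have : Group.IsSolvable N := isSolvable_semidirectProduct _
  exact isSolvable_semidirectProduct _

/-! ### Transport of the results on `C8C4 s` to isomorphic groups, in particular to the normalizer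
-/

section Iso

variable {M : Type} [Group M] (e : C8C4 s ≃* M)

theorem index_range_mulEquiv : (e : C8C4 s →* M).range.index = 1 := by
  rw [MonoidHom.range_eq_top.2 e.surjective, Subgroup.index_top]

theorem evenIdeal_pow_le_comap_mulEquiv (hs : s = 1 ∨ s = 2) :
    evenIdeal M ^ 6 ≤ (Ideal.span {2}).comap (res (e : C8C4 s →* M)) :=
  ((Ideal.pow_right_mono (evenIdeal_le_comap_res (e : C8C4 s →* M)) 6).trans
    (Ideal.le_comap_pow _ 6)).trans (Ideal.comap_mono (evenIdeal_pow_le hs))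

theorem exists_odd_avg_mulEquiv (hs : s = 1 ∨ s = 2) :
    ∃ f ∈ evenIdeal M ^ 5, Odd (avg (res (e : C8C4 s →* M) f)) := by
  obtain ⟨f, hf, hodd⟩ := exists_odd_avg hs
  refine ⟨res (e.symm : M →* C8C4 s) f, ?_, ?_⟩
  · exact Ideal.le_comap_pow _ 5
      (Ideal.pow_right_mono (evenIdeal_le_comap_res (e.symm : M →* C8C4 s)) 5 hf)
  · have : res (e : C8C4 s →* M) (res (e.symm : M →* C8C4 s) f) = f := by
      ext x
      exact congrArg f.1 (e.symm_apply_apply x)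
    rwa [this]

variable [Finite M] (O : Type*) [CommRing O] [IsDomain O] [CharZero O] [IsLocalRing O]
  [CharP (IsLocalRing.ResidueField O) 2]

include e in
theorem existsUnique_isCharFun_of_mulEquiv : ∃! f : Irr M O, IsCharFun (pElements 2 M) f :=
  existsUnique_isCharFun_of_injective (j := (e : C8C4 s →* M)) O e.injective isPGroup_C8C4
    (Or.inl (index_range_mulEquiv e))

include e in
theorem loewyLength_principalBlock_of_mulEquiv (hs : s = 1 ∨ s = 2) :
    loewyLength (PrincipalBlock O 2 M) = 6 :=
  loewyLength_principalBlock_of_injective (j := (e : C8C4 s →* M)) O e.injective isPGroup_C8C4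
    (Or.inl (index_range_mulEquiv e)) 5 (evenIdeal_pow_le_comap_mulEquiv e hs)
    (exists_odd_avg_mulEquiv e hs)

end Iso

end Main

end CharacterRing

open CharacterRing in
theorem mainTheorem1 (O : Type*) [CommRing O] [IsDomain O] [IsDiscreteValuationRing O]
    [CharZero O] [IsAdicComplete (IsLocalRing.maximalIdeal O) O]
    [IsAlgClosed (IsLocalRing.ResidueField O)] [CharP (IsLocalRing.ResidueField O) 2]
    (s : ZMod 8) (hs : s = 1 ∨ s = 2) (P : Sylow 2 (C8C3C4 s)) :
    Nat.card (C8C3C4 s) = 768 ∧ Group.IsSolvable (C8C3C4 s) ∧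
    (∃! e : Irr (C8C3C4 s) O, IsCharFun (pElements 2 (C8C3C4 s)) e) ∧
    loewyLength (PrincipalBlock O 2 (C8C3C4 s)) = 5 ∧
    (∃! e : Irr (Subgroup.normalizer (P : Set (C8C3C4 s))) O,
      IsCharFun (pElements 2 (Subgroup.normalizer (P : Set (C8C3C4 s)))) e) ∧
    loewyLength (PrincipalBlock O 2 (Subgroup.normalizer (P : Set (C8C3C4 s)))) = 6 := by
  obtain ⟨e⟩ := nonempty_mulEquiv_normalizer P
  exact ⟨card_C8C3C4, isSolvable_C8C3C4,
    existsUnique_isCharFun_of_injective O inclSylow_injective isPGroup_C8C4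
      (Or.inr index_range_inclSylow),
    loewyLength_principalBlock_of_injective O inclSylow_injective isPGroup_C8C4
      (Or.inr index_range_inclSylow) 4 (evenIdeal_pow_le_comap hs) exists_odd_avg_res,
    existsUnique_isCharFun_of_mulEquiv e O, loewyLength_principalBlock_of_mulEquiv e O hs⟩
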